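/- Let $r\ge 2$, let $\mathbb F$ be the free group on $a_1,\dots,a_r$, let $S=\{a_i^{\pm1}\}_{i=1}^r$, and let $|g|$ be the word length of $g\in\mathbb F$ and $d(g,h)=|g^{-1}h|$. Let $\mathbb F^2<\mathbb F$ be the subgroup generated by the elements of even length. Let $\partial\mathbb F$ be the set of all sequences $\xi=(\xi_1,\xi_2,\dots)\in S^{\mathbb N}$ with $\xi_{i+1}\ne\xi_i^{-1}$ for all $i$, with its product Borel structure, with the action of $\mathbb F$ by left multiplication and reduction, and with the Borel probability measure $\nu$ that satisfies $\nu(\{\xi:\xi_i=t_i,\ 1\le i\le n\})=(2r)^{-1}(2r-1)^{-n+1}$ for every reduced word $t_1\cdots t_n$, $n\ge1$. For $\xi\in\partial\mathbb F$ let $h_\xi(g)=\lim_{n\to\infty}\bigl(d(g,\xi_1\cdots\xi_n)-n\bigr)$ and $H_\xi=\{g\in\mathbb F:h_\xi(g)=0\}$. Let $\mathbb F$ act by measure-preserving transformations on a standard Borel probability space $(X,\lambda)$, and let it act diagonally on $(X\times\partial\mathbb F,\lambda\times\nu)$: $g(x,\xi)=(gx,g\xi)$. Let $\mathcal R_0(X\times\partial\mathbb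 F)$ be the relation under which $(x,\xi)$ is equivalent to $(g^{-1}x,g^{-1}\xi)$ for all $g\in H_\xi$. 1. For every $F\in L^1(X\times\partial\mathbb F)$, $$\mathbb E[F\mid\mathbb F^2]=\mathbb E[F\mid\mathcal R_0(X\times\partial\mathbb F)]\quad\text{a.e.},$$ where the left side is the conditional expectation on the $\sigma$-algebra of $\mathbb F^2$-invariant measurable sets and the right side the one on the $\sigma$-algebra of $\mathcal R_0(X\times\partial\mathbb F)$-invariant measurable sets (the measurable sets that are unions of equivalence classes). 2. If $f\in L^1(X\times\partial\mathbb F)$ satisfies $f\circ\phi=f$ a.e. for every Borel automorphism $\phi$ of $X\times\partial\mathbb F$ whose graph is contained in $\mathcal R_0(X\times\partial\mathbb F)$, then $f\circ P^2=f$ a.e., where $P^2(x,\xi)=(\xi_1\xi_2)^{-1}(x,\xi)$. Functions may be real- or complex-valued. -/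

import Mathlib

open MeasureTheory Filter Topology

namespace FreeGroupBoundary

/-- The letters of the symmetric generating set `S = {a_i, a_i⁻¹}` of the free group on `r`
generators: `(i, true)` stands for `a_i` and `(i, false)` for `a_i⁻¹`. This is Mathlib's
convention for the words that represent elements of `FreeGroup (Fin r)`. -/
abbrev Letter (r : ℕ) : Type := Fin r × Bool

/-- The inverse letter. -/
def invLetter {r : ℕ} (a : Letter r) : Letter r := (a.1, !a.2)

theorem invLetter_invLetter {r : ℕ} (a : Letter r) : invLetter (invLetter a) = a := by
  simp [invLetter]

/-- The boundary of the free group: infinite sequences of letters `ξ 0, ξ 1, …` without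
cancellation, that is, `ξ (i + 1) ≠ (ξ i)⁻¹` for all `i`. -/
@[ext]
structure Boundary (r : ℕ) : Type where
  /-- The sequence of letters. -/
  seq : ℕ → Letter r
  reduced : ∀ i, seq (i + 1) ≠ invLetter (seq i)

/-- The σ-algebra generated by the coordinates; as there are finitely many letters, it is the Borel
σ-algebra of the product topology. -/
instance instMeasurableSpaceBoundary (r : ℕ) : MeasurableSpace (Boundary r) := MeasurableSpace.comap Boundary.seq inferInstance

/-- Removing the first letter. -/
def Boundary.tail {r : ℕ} (ξ : Boundary r) : Boundary r :=
  ⟨fun i => ξ.seq (i + 1), fun i => ξ.reduced (i + 1)⟩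

/-- Putting a letter in front, where this creates no cancellation. -/
def Boundary.cons {r : ℕ} (a : Letter r) (ξ : Boundary r) (h : ξ.seq 0 ≠ invLetter a) :
    Boundary r :=
  ⟨fun i => Nat.casesOn i a ξ.seq, fun i => by
    cases i with
    | zero => exact h
    | succ i => exact ξ.reduced i⟩

/-- Left multiplication of an infinite reduced word by a letter, followed by reduction. -/
def letterMul {r : ℕ} (a : Letter r) (ξ : Boundary r) : Boundary r :=
  if h : ξ.seq 0 = invLetter a then ξ.tail else ξ.cons a h

theorem letterMul_invLetter {r : ℕ} (a : Letter r) (ξ : Boundary r) :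
    letterMul (invLetter a) (letterMul a ξ) = ξ := by
  by_cases h : ξ.seq 0 = invLetter a
  · have h1 : letterMul a ξ = ξ.tail := dif_pos h
    have h2 : ¬ (ξ.tail).seq 0 = invLetter (invLetter a) := by
      rw [← h]
      exact ξ.reduced 0
    rw [h1, letterMul, dif_neg h2]
    apply Boundary.ext
    funext i
    cases i with
    | zero => exact h.symm
    | succ i => rfl
  · have h1 : letterMul a ξ = ξ.cons a h := dif_neg h
    have h2 : (ξ.cons a h).seq 0 = invLetter (invLetter a) := by
      rw [invLetter_invLetter]
      rfl
    rw [h1, letterMul, dif_pos h2]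
    rfl

/-- Left multiplication by a letter, as a permutation of the boundary. -/
def letterPerm {r : ℕ} (a : Letter r) : Equiv.Perm (Boundary r) where
  toFun := letterMul a
  invFun := letterMul (invLetter a)
  left_inv := letterMul_invLetter a
  right_inv ξ := by
    have h := letterMul_invLetter (invLetter a) ξ
    rwa [invLetter_invLetter] at h

/-- The natural action of the free group on its boundary: the generator `a_i` acts by left
multiplication followed by reduction, so that a reduced word `t_1 ⋯ t_n` acts by concatenation and
cancellation. -/
instance instMulActionBoundary (r : ℕ) : MulAction (FreeGroup (Fin r)) (Boundary r) :=
  MulAction.compHom (Boundary r)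
    (FreeGroup.lift fun i : Fin r => letterPerm ((i, true) : Letter r))

/-- The action of a word, letter by letter. -/
theorem mk_cons_smul {r : ℕ} (a : Letter r) (L : List (Letter r)) (ξ : Boundary r) :
    FreeGroup.mk (a :: L) • ξ = letterMul a (FreeGroup.mk L • ξ) := by
  have h1 : (FreeGroup.mk (a :: L) : FreeGroup (Fin r)) = FreeGroup.mk [a] * FreeGroup.mk L := by
    rw [FreeGroup.mul_mk]
    rfl
  rw [h1, mul_smul]
  generalize FreeGroup.mk L • ξ = η
  obtain ⟨i, b⟩ := a
  change (FreeGroup.lift (fun i : Fin r => letterPerm ((i, true) : Letter r))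
    (FreeGroup.mk [(i, b)])) η = _
  rw [FreeGroup.lift_mk]
  cases b <;> simp [letterPerm, invLetter, Equiv.Perm.inv_def]

section Measure

/-- There are `2r - 1` letters that may follow a given letter. -/
theorem card_next {r : ℕ} (a : Letter r) :
    Fintype.card {b : Letter r // b ≠ invLetter a} = 2 * r - 1 := by
  simp [Fintype.card_subtype_compl, mul_comm]

/-- A numbering of the letters that may follow the letter `a`. -/
noncomputable def nextLetter {r : ℕ} (a : Letter r) :
    Fin (2 * r - 1) ≃ {b : Letter r // b ≠ invLetter a} :=
  (Fintype.equivFinOfCardEq (card_next a)).symm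

/-- The sequence with first letter `a` whose `(i + 1)`-st letter is the one with number `u i` among
those that may follow the `i`-th letter. -/
noncomputable def codeSeq {r : ℕ} (a : Letter r) (u : ℕ → Fin (2 * r - 1)) : ℕ → Letter r
  | 0 => a
  | i + 1 => (nextLetter (codeSeq a u i) (u i)).1

/-- The coding of boundary points by a first letter and a sequence of numbers. -/
noncomputable def code {r : ℕ} (p : Letter r × (ℕ → Fin (2 * r - 1))) : Boundary r :=
  ⟨codeSeq p.1 p.2, fun i => (nextLetter (codeSeq p.1 p.2 i) (p.2 i)).2⟩

theorem measurable_code {r : ℕ} : Measurable (code (r := r)) := by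
  rw [measurable_comap_iff, measurable_pi_iff]
  simp only [Function.comp_apply, code]
  intro i
  induction i with
  | zero => exact measurable_fst
  | succ i ih =>
    have h : Measurable fun q : Letter r × Fin (2 * r - 1) => (nextLetter q.1 q.2).1 :=
      measurable_of_countable _
    have h2 : Measurable fun p : Letter r × (ℕ → Fin (2 * r - 1)) => p.2 i :=
      (measurable_pi_apply i).comp measurable_snd
    have h3 := h.comp (ih.prodMk h2)
    simpa only [code, codeSeq, Function.comp_def] using h3

/-- The measure `ν` on the boundary of the free group: the first letter is uniformly distributed,
and each further letter is uniformly distributed among those that may follow the previous one,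
independently of the earlier choices. By `boundaryMeasure_cylinder` it is the Borel measure which
gives each set of sequences with a prescribed reduced beginning of length `n ≥ 1` the mass
`(2r)⁻¹ (2r - 1)^(-n + 1)`. -/
noncomputable def boundaryMeasure (r : ℕ) : Measure (Boundary r) :=
  Measure.map code
    ((ProbabilityTheory.uniformOn (Set.univ : Set (Letter r))).prod
      (Measure.infinitePi fun _ : ℕ =>
        ProbabilityTheory.uniformOn (Set.univ : Set (Fin (2 * r - 1)))))

theorem isProbabilityMeasure_boundaryMeasure {r : ℕ} (hr : 2 ≤ r) :
    IsProbabilityMeasure (boundaryMeasure r) := by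
  have : NeZero r := ⟨by omega⟩
  have : NeZero (2 * r - 1) := ⟨by omega⟩
  exact Measure.isProbabilityMeasure_map measurable_code.aemeasurable

/-- The mass of a cylinder: here the prescribed beginning is `η 0, …, η n`. -/
theorem boundaryMeasure_cylinder {r : ℕ} (hr : 2 ≤ r) (η : Boundary r) (n : ℕ) :
    boundaryMeasure r {ξ | ∀ i ≤ n, ξ.seq i = η.seq i} =
      (2 * r : ENNReal)⁻¹ * ((2 * r - 1 : ℕ) : ENNReal)⁻¹ ^ n := by
  have : NeZero r := ⟨by omega⟩
  have : NeZero (2 * r - 1) := ⟨by omega⟩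
  have hm : MeasurableSet {ξ : Boundary r | ∀ i ≤ n, ξ.seq i = η.seq i} := by
    have : {ξ : Boundary r | ∀ i ≤ n, ξ.seq i = η.seq i}
        = ⋂ i, ⋂ _ : i ≤ n, {ξ : Boundary r | ξ.seq i = η.seq i} := by
      ext
      simp
    rw [this]
    refine MeasurableSet.iInter fun i => MeasurableSet.iInter fun _ => ?_
    exact ((measurable_pi_apply i).comp (comap_measurable Boundary.seq))
      (MeasurableSet.singleton (η.seq i))
  have hpre : code ⁻¹' {ξ : Boundary r | ∀ i ≤ n, ξ.seq i = η.seq i} =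
      {η.seq 0} ×ˢ Set.pi (Finset.range n)
        (fun i => {(nextLetter (η.seq i)).symm ⟨η.seq (i + 1), η.reduced i⟩}) := by
    ext ⟨a, u⟩
    simp only [Set.mem_preimage, Set.mem_ofPred_eq, Set.mem_prod, Set.mem_singleton_iff, Set.mem_pi,
      Finset.coe_range, Set.mem_Iio]
    have key : ∀ i, codeSeq a u i = η.seq i →
        (codeSeq a u (i + 1) = η.seq (i + 1) ↔
          u i = (nextLetter (η.seq i)).symm ⟨η.seq (i + 1), η.reduced i⟩) := by
      intro i hi
      rw [Equiv.eq_symm_apply, Subtype.ext_iff]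
      change (nextLetter (codeSeq a u i) (u i)).1 = _ ↔ _
      rw [hi]
    constructor
    · intro h
      exact ⟨h 0 (Nat.zero_le _), fun i hi => (key i (h i hi.le)).1 (h (i + 1) hi)⟩
    · rintro ⟨h0, h⟩ i
      induction i with
      | zero => exact fun _ => h0
      | succ i ih => exact fun hi => (key i (ih (by omega))).2 (h i (by omega))
  have hpi := Measure.infinitePi_pi
    (μ := fun _ : ℕ => ProbabilityTheory.uniformOn (Set.univ : Set (Fin (2 * r - 1))))
    (s := Finset.range n)
    (t := fun i => {(nextLetter (η.seq i)).symm ⟨η.seq (i + 1), η.reduced i⟩})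
    (fun i _ => MeasurableSet.singleton _)
  rw [boundaryMeasure, Measure.map_apply measurable_code hm, hpre, Measure.prod_prod]
  erw [hpi]
  simp [ProbabilityTheory.uniformOn_univ, mul_comm]

end Measure

section Horospheres

/-- The finite beginning `s_n = ξ_1 ⋯ ξ_n` of a boundary point, as an element of the free group. -/
def prefixElt {r : ℕ} (ξ : Boundary r) (n : ℕ) : FreeGroup (Fin r) :=
  FreeGroup.mk (List.ofFn fun i : Fin n => ξ.seq i)

/-- The word metric `d(g, h) = |g⁻¹ h|` of the free group. -/
def wordDist {r : ℕ} (g h : FreeGroup (Fin r)) : ℕ := (g⁻¹ * h).norm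

/-- The horofunction `h_ξ(g) = lim_n (d(g, s_n) - n)` of the boundary point `ξ`, where
`s_n = ξ_1 ⋯ ξ_n`. The limit exists by `tendsto_horofunction`. -/
noncomputable def horofunction {r : ℕ} (ξ : Boundary r) (g : FreeGroup (Fin r)) : ℤ :=
  limUnder atTop fun n : ℕ => (wordDist g (prefixElt ξ n) : ℤ) - n

theorem prefixElt_succ {r : ℕ} (ξ : Boundary r) (n : ℕ) :
    prefixElt ξ (n + 1) = prefixElt ξ n * FreeGroup.mk [ξ.seq n] := by
  simp only [prefixElt, FreeGroup.mul_mk, List.ofFn_succ', List.concat_eq_append, Fin.val_castSucc,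
    Fin.val_last]

theorem norm_prefixElt {r : ℕ} (ξ : Boundary r) (n : ℕ) : (prefixElt ξ n).norm = n := by
  have h : FreeGroup.IsReduced (List.ofFn fun i : Fin n => ξ.seq i) := by
    rw [FreeGroup.IsReduced, List.isChain_iff_getElem]
    intro i hi h1
    simp only [List.getElem_ofFn] at h1 ⊢
    by_contra h2
    refine ξ.reduced i (Prod.ext h1.symm ?_)
    simp only [invLetter]
    cases h3 : (ξ.seq i).2 <;> cases h4 : (ξ.seq (i + 1)).2 <;> simp_all
  rw [FreeGroup.norm, prefixElt, FreeGroup.toWord_mk, h.reduce_eq, List.length_ofFn]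

theorem tendsto_horofunction {r : ℕ} (ξ : Boundary r) (g : FreeGroup (Fin r)) :
    Tendsto (fun n : ℕ => (wordDist g (prefixElt ξ n) : ℤ) - n) atTop
      (𝓝 (horofunction ξ g)) := by
  apply tendsto_nhds_limUnder
  refine ⟨_, tendsto_atTop_ciInf (antitone_nat_of_succ_le fun n => ?_) ⟨-(g.norm : ℤ), ?_⟩⟩
  · have h1 := FreeGroup.norm_mul_le (g⁻¹ * prefixElt ξ n) (FreeGroup.mk [ξ.seq n])
    have h2 : (FreeGroup.mk [ξ.seq n]).norm ≤ 1 := FreeGroup.norm_mk_le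
    rw [mul_assoc, ← prefixElt_succ] at h1
    simp only [wordDist]
    push_cast
    omega
  · rintro _ ⟨n, rfl⟩
    have h1 := FreeGroup.norm_mul_le g (g⁻¹ * prefixElt ξ n)
    rw [mul_inv_cancel_left, norm_prefixElt] at h1
    simp only [wordDist]
    omega

/-- The horosphere `H_ξ = {g : h_ξ(g) = 0}` through the identity. -/
def horosphere {r : ℕ} (ξ : Boundary r) : Set (FreeGroup (Fin r)) :=
  {g | horofunction ξ g = 0}

/-- The relation `𝓡₀(X × ∂𝔽)`: the point `(x, ξ)` is related to `(g⁻¹ x, g⁻¹ ξ)` for all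
`g ∈ H_ξ`. (On the product, `•` is the diagonal action.) -/
def horoRel {r : ℕ} {X : Type*} [MulAction (FreeGroup (Fin r)) X] (p q : X × Boundary r) : Prop :=
  ∃ g ∈ horosphere p.2, q = g⁻¹ • p

/-- The map `P^n(x, ξ) = (ξ_1 ⋯ ξ_n)⁻¹ (x, ξ)`. -/
def shiftMap {r : ℕ} {X : Type*} [MulAction (FreeGroup (Fin r)) X] (n : ℕ) (p : X × Boundary r) :
    X × Boundary r :=
  (prefixElt p.2 n)⁻¹ • p

end Horospheres

/-- The subgroup `𝔽²` generated by all elements of even length. -/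
def evenSubgroup (r : ℕ) : Subgroup (FreeGroup (Fin r)) :=
  Subgroup.closure {g | Even g.norm}

section Invariants

/-- The σ-algebra of the measurable sets that are invariant under a relation. -/
def relInvariants {B : Type*} [MeasurableSpace B] (R : B → B → Prop) : MeasurableSpace B where
  MeasurableSet' E := MeasurableSet E ∧ ∀ b b', R b b' → (b ∈ E ↔ b' ∈ E)
  measurableSet_empty := ⟨MeasurableSet.empty, fun _ _ _ => Iff.rfl⟩
  measurableSet_compl E hE := ⟨hE.1.compl, fun b b' h => not_congr (hE.2 b b' h)⟩
  measurableSet_iUnion E hE := ⟨MeasurableSet.iUnion fun n => (hE n).1, fun b b' h => by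
    simp only [Set.mem_iUnion]
    exact exists_congr fun n => (hE n).2 b b' h⟩

/-- The σ-algebra of the measurable sets that are invariant under (every element of) a group. -/
def groupInvariants (H : Type*) [Group H] (B : Type*) [MeasurableSpace B] [MulAction H B] :
    MeasurableSpace B where
  MeasurableSet' E := MeasurableSet E ∧ ∀ g : H, (fun b : B => g • b) ⁻¹' E = E
  measurableSet_empty := ⟨MeasurableSet.empty, fun _ => rfl⟩
  measurableSet_compl E hE := ⟨hE.1.compl, fun g => by rw [Set.preimage_compl, hE.2 g]⟩
  measurableSet_iUnion E hE := ⟨MeasurableSet.iUnion fun n => (hE n).1, fun g => by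
    rw [Set.preimage_iUnion]
    exact Set.iUnion_congr fun n => (hE n).2 g⟩

theorem relInvariants_le {B : Type*} [m : MeasurableSpace B] (R : B → B → Prop) :
    relInvariants R ≤ m := fun _ h => h.1

theorem groupInvariants_le (H : Type*) [Group H] (B : Type*) [m : MeasurableSpace B]
    [MulAction H B] : groupInvariants H B ≤ m := fun _ h => h.1

/-- The inner automorphisms of a relation: the Borel automorphisms whose graph is contained in it. -/
def IsInner {B : Type*} [MeasurableSpace B] (R : B → B → Prop) (φ : B ≃ᵐ B) : Prop :=
  ∀ b, R b (φ b)

end Invariants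

end FreeGroupBoundary

/-! Let `shift` be P(x, ξ) = ξ_1⁻¹(x, ξ). It has 2r - 1 inverse branches `extend j`, one for each
letter that does not cancel with ξ_1. The product measure is the average of its images under the
branches, so P preserves it, and the average over the branches is a transfer operator T that
contracts L¹.

Points with equal P^n-image lie in one horospherical class. A function f invariant under inner
automorphisms is therefore invariant under permutations of the branches at every level, which gives
f = T^n f ∘ P^n for all n. Since P preserves the measure, ‖f ∘ P² - f‖₁ = ‖T^(n+2) f - T^n f‖₁ for
every n, and part 2 follows once the right side tends to 0 (`tendsto_lintegral_transfer_sub`).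

By density and contraction it suffices to take f depending on finitely many letters, and T removes
dependence on letters until only the first remains. On functions of x and the first letter, T = A J,
where J (`flip`) is an isometric involution and A is a symmetric matrix with eigenvalues 1 and
-1/(2r-1). As -1 is not an eigenvalue of A, ‖v‖² - ‖Av‖² controls ‖Av - v‖². The norms ‖T^n H‖
decrease, so T^(n+1) H - J T^n H tends to 0 in L², and J² = 1 gives T^(n+2) H - T^n H → 0.

For part 1, horospheres consist of elements of even length, so one σ-algebra contains the other.
Conversely, the indicator of a horospherically invariant set is P²-invariant by the argument above.
A product of two letters acts at each point by P², by a branch of its inverse, or within a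
horospherical class, so the set is almost invariant under the countable group 𝔽² and agrees a.e.
with an invariant set. -/

namespace FreeGroupBoundary

/-! ### The shift, its inverse branches, and the horospherical relation -/

section Dynamics

variable {r : ℕ} {X : Type*} [MulAction (FreeGroup (Fin r)) X]

/-- A letter acts on the boundary by letter multiplication. -/
theorem mk_singleton_smul (a : Letter r) (ξ : Boundary r) :
    (FreeGroup.mk [a] : FreeGroup (Fin r)) • ξ = letterMul a ξ := by
  rw [mk_cons_smul, ← FreeGroup.one_eq_mk, one_smul]

theorem mk_singleton_invLetter (a : Letter r) :
    (FreeGroup.mk [invLetter a] : FreeGroup (Fin r)) = (FreeGroup.mk [a])⁻¹ := by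
  rw [FreeGroup.inv_mk]
  simp [FreeGroup.invRev, invLetter]

theorem seq_zero_ne_invLetter_nextLetter (ξ : Boundary r) (j : Fin (2 * r - 1)) :
    ξ.seq 0 ≠ invLetter (nextLetter (ξ.seq 0) j).1 := by
  intro h
  refine (nextLetter (ξ.seq 0) j).2 ?_
  conv_rhs => rw [h]
  rw [invLetter_invLetter]

theorem seq_zero_ne_invLetter_seq_one (ξ : Boundary r) :
    ξ.seq 0 ≠ invLetter (ξ.seq 1) := by
  intro h
  refine ξ.reduced 0 ?_
  rw [h, invLetter_invLetter]

/-- The skew product over the shift: `(x, ξ) ↦ (ξ_1⁻¹ x, ξ_1⁻¹ ξ)`. -/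
def shift (p : X × Boundary r) : X × Boundary r :=
  ((FreeGroup.mk [p.2.seq 0] : FreeGroup (Fin r))⁻¹ • p.1, p.2.tail)

/-- Multiplication by the `j`-th letter that does not cancel with the boundary point. -/
noncomputable def extend (j : Fin (2 * r - 1)) (p : X × Boundary r) : X × Boundary r :=
  ((FreeGroup.mk [(nextLetter (p.2.seq 0) j).1] : FreeGroup (Fin r)) • p.1,
    p.2.cons (nextLetter (p.2.seq 0) j).1 (seq_zero_ne_invLetter_nextLetter p.2 j))

/-- The number of the first letter among the letters that do not cancel with the second one. -/
noncomputable def index (p : X × Boundary r) : Fin (2 * r - 1) :=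
  (nextLetter (p.2.seq 1)).symm ⟨p.2.seq 0, seq_zero_ne_invLetter_seq_one p.2⟩

@[simp]
theorem shift_extend (j : Fin (2 * r - 1)) (p : X × Boundary r) : shift (extend j p) = p := by
  refine Prod.ext ?_ ?_
  · exact inv_smul_smul _ _
  · rfl

@[simp]
theorem index_extend (j : Fin (2 * r - 1)) (p : X × Boundary r) : index (extend j p) = j := by
  rw [index, Equiv.symm_apply_eq]
  rfl

@[simp]
theorem extend_index_shift (p : X × Boundary r) : extend (index p) (shift p) = p := by
  have h : (nextLetter ((shift p).2.seq 0) (index p)).1 = p.2.seq 0 := by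
    change (nextLetter (p.2.seq 1) ((nextLetter (p.2.seq 1)).symm _)).1 = _
    rw [Equiv.apply_symm_apply]
  refine Prod.ext ?_ (Boundary.ext (funext fun i => ?_))
  · change (FreeGroup.mk [(nextLetter ((shift p).2.seq 0) (index p)).1] : FreeGroup (Fin r)) •
      ((FreeGroup.mk [p.2.seq 0] : FreeGroup (Fin r))⁻¹ • p.1) = p.1
    rw [h, smul_inv_smul]
  · cases i with
    | zero => exact h
    | succ i => rfl

theorem tail_eq_smul (ξ : Boundary r) :
    ξ.tail = (FreeGroup.mk [ξ.seq 0] : FreeGroup (Fin r))⁻¹ • ξ := by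
  rw [← mk_singleton_invLetter, mk_singleton_smul, letterMul,
    dif_pos (invLetter_invLetter _).symm]

theorem shift_eq_smul (p : X × Boundary r) :
    shift p = (FreeGroup.mk [p.2.seq 0] : FreeGroup (Fin r))⁻¹ • p :=
  Prod.ext rfl (tail_eq_smul p.2)

/-- A letter acts either by the shift or by a branch of its inverse. -/
theorem letter_smul_cases (a : Letter r) (p : X × Boundary r) :
    (FreeGroup.mk [a] : FreeGroup (Fin r)) • p = shift p ∨
      ∃ j, (FreeGroup.mk [a] : FreeGroup (Fin r)) • p = extend j p := by
  by_cases h : p.2.seq 0 = invLetter a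
  · left
    rw [shift_eq_smul, h, mk_singleton_invLetter, inv_inv]
  · right
    have h' : a ≠ invLetter (p.2.seq 0) := fun h2 => h (by rw [h2, invLetter_invLetter])
    refine ⟨(nextLetter (p.2.seq 0)).symm ⟨a, h'⟩, ?_⟩
    have h2 : (nextLetter (p.2.seq 0) ((nextLetter (p.2.seq 0)).symm ⟨a, h'⟩)).1 = a := by
      rw [Equiv.apply_symm_apply]
    refine Prod.ext ?_ (Boundary.ext (funext fun i => ?_))
    · simp only [extend, h2]
      rfl
    · rw [Prod.smul_snd, mk_singleton_smul, letterMul, dif_neg h]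
      cases i with
      | zero => exact h2.symm
      | succ i => rfl

theorem iterate_shift_snd_seq (n i : ℕ) (p : X × Boundary r) :
    (shift^[n] p).2.seq i = p.2.seq (n + i) := by
  induction n generalizing i with
  | zero => simp
  | succ n ih =>
    rw [Function.iterate_succ_apply']
    change (shift^[n] p).2.seq (i + 1) = _
    rw [ih]
    congr 1
    omega

theorem iterate_shift_eq_smul (n : ℕ) (p : X × Boundary r) :
    shift^[n] p = (prefixElt p.2 n)⁻¹ • p := by
  induction n with
  | zero => simp [prefixElt, ← FreeGroup.one_eq_mk]
  | succ n ih =>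
    rw [Function.iterate_succ_apply', shift_eq_smul, iterate_shift_snd_seq, add_zero,
      prefixElt_succ, mul_inv_rev, mul_smul, ← ih]

theorem shiftMap_eq_iterate (n : ℕ) : shiftMap (X := X) (r := r) n = shift^[n] :=
  funext fun p => (iterate_shift_eq_smul n p).symm

theorem prefixElt_add (ξ η : Boundary r) (n : ℕ) (h : ∀ i, ξ.seq (n + i) = η.seq (n + i)) (k : ℕ) :
    (prefixElt ξ n)⁻¹ * prefixElt ξ (n + k) = (prefixElt η n)⁻¹ * prefixElt η (n + k) := by
  induction k with
  | zero => simp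
  | succ k ih =>
    rw [← add_assoc, prefixElt_succ, prefixElt_succ, ← mul_assoc, ← mul_assoc, ih, h]

/-- Points with the same image under an iterate of the shift are equivalent. -/
theorem horoRel_of_iterate_shift_eq {n : ℕ} {p q : X × Boundary r}
    (h : shift^[n] p = shift^[n] q) : horoRel p q := by
  have hs : ∀ i, p.2.seq (n + i) = q.2.seq (n + i) := fun i => by
    rw [← iterate_shift_snd_seq, ← iterate_shift_snd_seq, h]
  -- This element exchanges the initial words of length n. Its inverse takes the longer prefixes of
  -- `p.2` to those of `q.2` of the same length, so the sequence defining the horofunction vanishes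
  -- from n on.
  refine ⟨prefixElt p.2 n * (prefixElt q.2 n)⁻¹, ?_, ?_⟩
  · refine tendsto_nhds_unique (tendsto_horofunction _ _) ?_
    refine tendsto_const_nhds.congr' ?_
    filter_upwards [eventually_ge_atTop n] with m hm
    obtain ⟨k, rfl⟩ := Nat.exists_eq_add_of_le hm
    rw [wordDist, mul_inv_rev, inv_inv, mul_assoc, prefixElt_add _ _ _ hs, mul_inv_cancel_left,
      norm_prefixElt, sub_self]
  · rw [iterate_shift_eq_smul, iterate_shift_eq_smul] at h
    rw [mul_inv_rev, inv_inv, mul_smul, h, smul_inv_smul]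

/-- The parity of the word length. -/
def parity (r : ℕ) : FreeGroup (Fin r) →* Multiplicative (ZMod 2) :=
  FreeGroup.lift fun _ => Multiplicative.ofAdd 1

theorem parity_eq (g : FreeGroup (Fin r)) :
    parity r g = Multiplicative.ofAdd (g.norm : ZMod 2) := by
  have key : ∀ L : List (Letter r),
      parity r (FreeGroup.mk L) = Multiplicative.ofAdd (L.length : ZMod 2) := by
    intro L
    induction L with
    | nil => simp [← FreeGroup.one_eq_mk]
    | cons a L ih =>
      have h1 : (FreeGroup.mk (a :: L) : FreeGroup (Fin r)) =
          FreeGroup.mk [a] * FreeGroup.mk L := by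
        rw [FreeGroup.mul_mk]
        rfl
      have h2 : parity r (FreeGroup.mk [a]) = Multiplicative.ofAdd 1 := by
        obtain ⟨i, b⟩ := a
        rw [parity, FreeGroup.lift_mk]
        cases b
        · simp only [List.map_cons, List.map_nil, cond_false, List.prod_cons, List.prod_nil]
          decide
        · simp
      rw [h1, map_mul, ih, h2, ← ofAdd_add, List.length_cons, Nat.cast_succ, add_comm]
  conv_lhs => rw [← FreeGroup.mk_toWord (x := g)]
  rw [key]
  rfl

theorem even_norm_iff (g : FreeGroup (Fin r)) : Even g.norm ↔ parity r g = 1 := by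
  rw [parity_eq, ← ofAdd_zero, Multiplicative.ofAdd.injective.eq_iff, ZMod.natCast_eq_zero_iff_even]

/-- Integer sequences converge only if eventually constant, so some n has |g⁻¹ s_n| = n = |s_n|.
Parity is a homomorphism, hence g has even length. -/
theorem horosphere_subset_evenSubgroup (ξ : Boundary r) :
    horosphere ξ ⊆ (evenSubgroup r : Set (FreeGroup (Fin r))) := by
  intro g hg
  refine Subgroup.subset_closure ?_
  have h1 := tendsto_horofunction ξ g
  rw [show horofunction ξ g = 0 from hg, nhds_discrete, tendsto_pure] at h1
  obtain ⟨n, hn⟩ := h1.exists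
  have h2 : (g⁻¹ * prefixElt ξ n).norm = n := by
    have : ((g⁻¹ * prefixElt ξ n).norm : ℤ) = n := sub_eq_zero.1 hn
    exact_mod_cast this
  have h3 := parity_eq (g⁻¹ * prefixElt ξ n)
  rw [h2, map_mul, map_inv, parity_eq (prefixElt ξ n), norm_prefixElt, mul_eq_right,
    inv_eq_one] at h3
  exact (even_norm_iff g).2 h3

theorem groupInvariants_le_relInvariants [MeasurableSpace X] :
    groupInvariants (evenSubgroup r) (X × Boundary r) ≤
      relInvariants (horoRel (r := r) (X := X)) := by
  rintro E ⟨hE, hinv⟩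
  refine ⟨hE, ?_⟩
  rintro p _ ⟨g, hg, rfl⟩
  have h := hinv ⟨g⁻¹, inv_mem (horosphere_subset_evenSubgroup p.2 hg)⟩
  exact (Set.ext_iff.1 h p).symm

end Dynamics

/-! ### Measurability of the action, the shift and its branches -/

section Measurability

variable {r : ℕ} {X : Type*} [MulAction (FreeGroup (Fin r)) X] [MeasurableSpace X]

theorem measurable_seq (i : ℕ) : Measurable fun ξ : Boundary r => ξ.seq i :=
  (measurable_pi_apply i).comp (comap_measurable Boundary.seq)

theorem measurable_boundary_iff {α : Type*} [MeasurableSpace α] {f : α → Boundary r} :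
    Measurable f ↔ ∀ i, Measurable fun x => (f x).seq i := by
  rw [measurable_comap_iff, measurable_pi_iff]
  rfl

theorem measurable_tail : Measurable (Boundary.tail (r := r)) :=
  measurable_boundary_iff.2 fun i => measurable_seq (i + 1)

theorem measurable_letterMul (a : Letter r) : Measurable (letterMul a) := by
  refine measurable_boundary_iff.2 fun i => ?_
  have h : (fun ξ : Boundary r => (letterMul a ξ).seq i) = fun ξ =>
      if ξ.seq 0 = invLetter a then ξ.seq (i + 1) else Nat.casesOn i a ξ.seq := by
    funext ξ
    by_cases h : ξ.seq 0 = invLetter a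
    · rw [letterMul, dif_pos h, if_pos h]
      rfl
    · rw [letterMul, dif_neg h, if_neg h]
      rfl
  rw [h]
  refine Measurable.ite (measurable_seq 0 (MeasurableSet.singleton _)) (measurable_seq _) ?_
  cases i with
  | zero => exact measurable_const
  | succ i => exact measurable_seq i

theorem measurable_boundary_smul (g : FreeGroup (Fin r)) :
    Measurable fun ξ : Boundary r => g • ξ := by
  have key : ∀ L : List (Letter r),
      Measurable fun ξ : Boundary r => (FreeGroup.mk L : FreeGroup (Fin r)) • ξ := by
    intro L
    induction L with
    | nil =>
      simp only [← FreeGroup.one_eq_mk, one_smul]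
      exact measurable_id
    | cons a L ih =>
      simp only [mk_cons_smul]
      exact (measurable_letterMul a).comp ih
  rw [← FreeGroup.mk_toWord (x := g)]
  exact key _

theorem measurable_letter_smul
    (hX : ∀ g : FreeGroup (Fin r), Measurable fun x : X => g • x) :
    Measurable fun z : Letter r × X => (FreeGroup.mk [z.1] : FreeGroup (Fin r)) • z.2 :=
  measurable_from_prod_countable_right fun a => hX (FreeGroup.mk [a])

theorem measurable_shift (hX : ∀ g : FreeGroup (Fin r), Measurable fun x : X => g • x) :
    Measurable (shift (r := r) (X := X)) := by
  have h : Measurable fun z : Letter r × X => (FreeGroup.mk [z.1] : FreeGroup (Fin r))⁻¹ • z.2 :=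
    measurable_from_prod_countable_right fun a => hX (FreeGroup.mk [a])⁻¹
  exact (h.comp (((measurable_seq 0).comp measurable_snd).prodMk measurable_fst)).prodMk
    (measurable_tail.comp measurable_snd)

omit [MulAction (FreeGroup (Fin r)) X] in
theorem measurable_index : Measurable (index (r := r) (X := X)) := by
  refine measurable_to_countable' fun j => ?_
  have h : index (X := X) ⁻¹' {j} = (fun p : X × Boundary r => (p.2.seq 1, p.2.seq 0)) ⁻¹'
      {z | ∃ h : z.2 ≠ invLetter z.1, (nextLetter z.1).symm ⟨z.2, h⟩ = j} := by
    ext p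
    exact ⟨fun hp => ⟨seq_zero_ne_invLetter_seq_one p.2, hp⟩, fun ⟨_, hp⟩ => hp⟩
  rw [h]
  exact (((measurable_seq 1).comp measurable_snd).prodMk ((measurable_seq 0).comp measurable_snd))
    MeasurableSet.of_discrete

omit [MulAction (FreeGroup (Fin r)) X] in
theorem measurable_nextLetter_seq_zero :
    Measurable fun z : Fin (2 * r - 1) × (X × Boundary r) =>
      (nextLetter (z.2.2.seq 0) z.1).1 := by
  have h1 : Measurable fun z : Fin (2 * r - 1) × Letter r => (nextLetter z.2 z.1).1 :=
    measurable_of_countable _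
  have h2 : Measurable fun z : Fin (2 * r - 1) × (X × Boundary r) => (z.1, z.2.2.seq 0) :=
    measurable_fst.prodMk
      ((measurable_seq 0).comp (measurable_snd.comp measurable_snd))
  have h := h1.comp h2
  exact h

theorem measurable_extend (hX : ∀ g : FreeGroup (Fin r), Measurable fun x : X => g • x) :
    Measurable fun z : Fin (2 * r - 1) × (X × Boundary r) => extend z.1 z.2 := by
  have h1 := measurable_nextLetter_seq_zero (r := r) (X := X)
  have h2 : Measurable fun z : Fin (2 * r - 1) × (X × Boundary r) =>
      ((nextLetter (z.2.2.seq 0) z.1).1, z.2.1) :=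
    h1.prodMk (measurable_fst.comp measurable_snd)
  refine Measurable.prodMk ?_ (measurable_boundary_iff.2 fun i => ?_)
  · exact (measurable_letter_smul hX).comp h2
  · cases i with
    | zero => exact h1
    | succ i => exact (measurable_seq i).comp (measurable_snd.comp measurable_snd)

theorem measurable_extend_apply (hX : ∀ g : FreeGroup (Fin r), Measurable fun x : X => g • x)
    (j : Fin (2 * r - 1)) : Measurable (extend (r := r) (X := X) j) :=
  by
  have h := (measurable_extend hX).comp
    (measurable_const (a := j).prodMk (measurable_id (α := X × Boundary r)))
  exact h

end Measurability

/-! ### Invariance of the product measure under the shift, and nonsingularity of the action -/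

section Invariance

variable {r : ℕ}

/-- The boundary component of `extend`. -/
noncomputable def Boundary.extend (j : Fin (2 * r - 1)) (ξ : Boundary r) : Boundary r :=
  ξ.cons (nextLetter (ξ.seq 0) j).1 (seq_zero_ne_invLetter_nextLetter ξ j)

theorem measurable_boundary_extend (j : Fin (2 * r - 1)) :
    Measurable (Boundary.extend (r := r) j) := by
  refine measurable_boundary_iff.2 fun i => ?_
  cases i with
  | zero =>
    have h1 : Measurable fun a : Letter r => (nextLetter a j).1 := measurable_of_countable _
    have h := h1.comp (measurable_seq 0)
    exact h
  | succ i => exact measurable_seq i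

/-- The sets of boundary points with a prescribed beginning. -/
def cylinder (w : ℕ → Letter r) (n : ℕ) : Set (Boundary r) := {ξ | ∀ i ≤ n, ξ.seq i = w i}

theorem measurableSet_cylinder (w : ℕ → Letter r) (n : ℕ) : MeasurableSet (cylinder w n) := by
  have : cylinder w n = ⋂ i, ⋂ _ : i ≤ n, (fun ξ : Boundary r => ξ.seq i) ⁻¹' {w i} := by
    ext
    simp [cylinder]
  rw [this]
  exact MeasurableSet.iInter fun i => MeasurableSet.iInter fun _ =>
    measurable_seq i (MeasurableSet.singleton _)

/-- The cylinders that prescribe at least two letters. -/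
def longCylinders (r : ℕ) : Set (Set (Boundary r)) := {C | ∃ w n, C = cylinder w (n + 1)}

theorem isPiSystem_longCylinders : IsPiSystem (longCylinders r) := by
  rintro _ ⟨w, n, rfl⟩ _ ⟨v, m, rfl⟩ ⟨ξ, h1, h2⟩
  refine ⟨ξ.seq, max n m, ?_⟩
  ext η
  constructor
  · rintro ⟨h3, h4⟩ i hi
    rcases le_total n m with h | h
    · rw [max_eq_right h] at hi
      rw [h4 i hi, h2 i hi]
    · rw [max_eq_left h] at hi
      rw [h3 i hi, h1 i hi]
  · intro h
    exact ⟨fun i hi => by rw [h i (by omega), h1 i hi], fun i hi => by rw [h i (by omega), h2 i hi]⟩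

theorem generateFrom_longCylinders :
    instMeasurableSpaceBoundary r = MeasurableSpace.generateFrom (longCylinders r) := by
  refine le_antisymm ?_ (MeasurableSpace.generateFrom_le ?_)
  · suffices hm : @Measurable _ _ (MeasurableSpace.generateFrom (longCylinders r)) _
        (Boundary.seq (r := r)) from hm.comap_le
    refine (@measurable_pi_iff _ _ _ (MeasurableSpace.generateFrom (longCylinders r)) _ _).2
      fun i => ?_
    refine @measurable_to_countable' _ _ _ _ (MeasurableSpace.generateFrom (longCylinders r)) _
      fun a => ?_
    have : (fun ξ : Boundary r => ξ.seq i) ⁻¹' {a} =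
        ⋃ w : {w : Fin (i + 2) → Letter r // w ⟨i, by omega⟩ = a},
          cylinder (fun k => if h : k < i + 2 then w.1 ⟨k, h⟩ else a) (i + 1) := by
      ext ξ
      simp only [Set.mem_preimage, Set.mem_singleton_iff, Set.mem_iUnion]
      constructor
      · intro h
        refine ⟨⟨fun k => ξ.seq k, h⟩, fun k hk => ?_⟩
        have hk' : k < i + 2 := by omega
        simp only [dif_pos hk']
      · rintro ⟨⟨w, hw⟩, h⟩
        have h1 := h i (by omega)
        exact h1.trans ((dif_pos (show i < i + 2 by omega)).trans hw)
    rw [this]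
    exact MeasurableSet.iUnion fun w => MeasurableSpace.measurableSet_generateFrom ⟨_, _, rfl⟩
  · rintro _ ⟨w, n, rfl⟩
    exact measurableSet_cylinder w (n + 1)

/-- The boundary measure is invariant under adding a random first letter. -/
theorem smul_boundaryMeasure_eq_sum (hr : 2 ≤ r) :
    ((2 * r - 1 : ℕ) : ENNReal) • boundaryMeasure r =
      ∑ j : Fin (2 * r - 1), (boundaryMeasure r).map (Boundary.extend j) := by
  have := isProbabilityMeasure_boundaryMeasure hr
  have : IsFiniteMeasure (((2 * r - 1 : ℕ) : ENNReal) • boundaryMeasure r) :=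
    Measure.smul_finite _ (ENNReal.natCast_ne_top _)
  have hq0 : ((2 * r - 1 : ℕ) : ENNReal) ≠ 0 := by
    rw [Ne, Nat.cast_eq_zero]
    omega
  refine ext_of_generate_finite (longCylinders r) generateFrom_longCylinders
    isPiSystem_longCylinders ?_ ?_
  · rintro _ ⟨w, n, rfl⟩
    rw [Measure.smul_apply, Measure.finsetSum_apply]
    simp only [Measure.map_apply (measurable_boundary_extend _) (measurableSet_cylinder w (n + 1))]
    -- The word w need not be reduced, so its cylinder may be empty. Otherwise a point η of it
    -- provides a reduced word with the same beginning.
    rcases (cylinder w (n + 1)).eq_empty_or_nonempty with h | ⟨η, hη⟩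
    · simp [h]
    have hw : cylinder w (n + 1) = {ξ | ∀ i ≤ n + 1, ξ.seq i = η.seq i} := by
      ext ξ
      exact ⟨fun h i hi => by rw [h i hi, hη i hi], fun h i hi => by rw [h i hi, hη i hi]⟩
    -- Only the branch k that prepends η_1 to a sequence starting with η_2 can reach the cylinder.
    -- Its preimage is the cylinder of the tail, one letter shorter and so 2r - 1 times heavier. Two
    -- prescribed letters are needed for the shorter cylinder to prescribe at least one.
    set k := (nextLetter (η.seq 1)).symm ⟨η.seq 0, seq_zero_ne_invLetter_seq_one η⟩ with hk
    have hkey : ∀ ξ : Boundary r, ∀ j, ξ.seq 0 = η.seq 1 →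
        ((nextLetter (ξ.seq 0) j).1 = η.seq 0 ↔ j = k) := by
      intro ξ j h
      rw [h, hk, Equiv.eq_symm_apply, Subtype.ext_iff]
    rw [Finset.sum_eq_single k]
    · have h2 : Boundary.extend k ⁻¹' cylinder w (n + 1) =
          {ξ | ∀ i ≤ n, ξ.seq i = η.tail.seq i} := by
        rw [hw]
        ext ξ
        constructor
        · exact fun h i hi => h (i + 1) (by omega)
        · rintro h (_ | i) hi
          · exact (hkey ξ k (h 0 (by omega))).2 rfl
          · exact h i (by omega)
      rw [h2, hw, boundaryMeasure_cylinder hr, boundaryMeasure_cylinder hr, smul_eq_mul, pow_succ,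
        mul_comm, mul_assoc, mul_assoc, ENNReal.inv_mul_cancel hq0 (ENNReal.natCast_ne_top _),
        mul_one]
    · intro j _ hj
      have h2 : Boundary.extend j ⁻¹' cylinder w (n + 1) = ∅ := by
        rw [hw]
        refine Set.eq_empty_of_forall_notMem fun ξ h => hj ?_
        exact (hkey ξ j (h 1 (by omega))).1 (h 0 (by omega))
      rw [h2, measure_empty]
    · simp
  · rw [Measure.smul_apply, Measure.finsetSum_apply]
    simp [Measure.map_apply (measurable_boundary_extend _)]

variable {X : Type*} [MeasurableSpace X] [MulAction (FreeGroup (Fin r)) X] {lam : Measure X}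

/-- The product measure is invariant under adding a random first letter. -/
theorem mul_lintegral_eq_sum_extend [IsProbabilityMeasure lam] (hr : 2 ≤ r)
    (hlam : ∀ g : FreeGroup (Fin r), MeasurePreserving (fun x : X => g • x) lam lam)
    {f : X × Boundary r → ENNReal} (hf : Measurable f) :
    ((2 * r - 1 : ℕ) : ENNReal) * ∫⁻ p, f p ∂lam.prod (boundaryMeasure r) =
      ∑ j, ∫⁻ p, f (extend j p) ∂lam.prod (boundaryMeasure r) := by
  have := isProbabilityMeasure_boundaryMeasure hr
  have hX := fun g => (hlam g).measurable
  have hinner : Measurable fun ξ : Boundary r => ∫⁻ x, f (x, ξ) ∂lam := hf.lintegral_prod_left'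
  have key : ∀ j, ∫⁻ p, f (extend j p) ∂lam.prod (boundaryMeasure r) =
      ∫⁻ ξ, ∫⁻ x, f (x, ξ) ∂lam ∂(boundaryMeasure r).map (Boundary.extend j) := by
    intro j
    have hm : Measurable fun p : X × Boundary r => f (extend j p) :=
      hf.comp (measurable_extend_apply hX j)
    rw [lintegral_prod_symm _ hm.aemeasurable,
      lintegral_map hinner (measurable_boundary_extend j)]
    -- For fixed ξ the branch moves x by one fixed group element, which preserves `lam`.
    refine lintegral_congr fun ξ => ?_
    exact (hlam (FreeGroup.mk [(nextLetter (ξ.seq 0) j).1])).lintegral_comp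
      (f := fun x => f (x, Boundary.extend j ξ)) (hf.comp measurable_prodMk_right)
  simp only [key]
  rw [← lintegral_finsetSum_measure, ← smul_boundaryMeasure_eq_sum hr, lintegral_smul_measure,
    lintegral_prod_symm _ hf.aemeasurable, smul_eq_mul]

variable [IsProbabilityMeasure lam]

theorem measurePreserving_shift (hr : 2 ≤ r)
    (hlam : ∀ g : FreeGroup (Fin r), MeasurePreserving (fun x : X => g • x) lam lam) :
    MeasurePreserving (shift (r := r) (X := X)) (lam.prod (boundaryMeasure r))
      (lam.prod (boundaryMeasure r)) := by
  have hX := fun g => (hlam g).measurable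
  refine ⟨measurable_shift hX, Measure.ext_of_lintegral _ fun f hf => ?_⟩
  rw [lintegral_map hf (measurable_shift hX)]
  -- Every branch is a right inverse of the shift, so all 2r - 1 summands equal the integral of f.
  have h := mul_lintegral_eq_sum_extend hr hlam (hf.comp (measurable_shift hX))
  simp only [Function.comp_apply, shift_extend, Finset.sum_const, Finset.card_univ,
    Fintype.card_fin, nsmul_eq_mul] at h
  have hq0 : ((2 * r - 1 : ℕ) : ENNReal) ≠ 0 := by
    rw [Ne, Nat.cast_eq_zero]
    omega
  exact (ENNReal.mul_right_inj hq0 (ENNReal.natCast_ne_top _)).1 h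

/-- The masses of the preimages of a set under all branches add up to 2r - 1 times its mass, so each
of them is null if the set is. -/
theorem quasiMeasurePreserving_extend (hr : 2 ≤ r)
    (hlam : ∀ g : FreeGroup (Fin r), MeasurePreserving (fun x : X => g • x) lam lam)
    (j : Fin (2 * r - 1)) :
    Measure.QuasiMeasurePreserving (extend (r := r) (X := X) j) (lam.prod (boundaryMeasure r))
      (lam.prod (boundaryMeasure r)) := by
  have hX := fun g => (hlam g).measurable
  have hm := measurable_extend_apply hX j
  refine ⟨hm, Measure.AbsolutelyContinuous.mk fun s hs h0 => ?_⟩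
  have h := mul_lintegral_eq_sum_extend hr hlam (measurable_one.indicator hs)
  rw [lintegral_indicator_one hs, h0, mul_zero, eq_comm, Finset.sum_eq_zero_iff] at h
  rw [Measure.map_apply hm hs]
  refine Eq.trans ?_ (h j (Finset.mem_univ j))
  rw [← lintegral_indicator_one (hm hs)]
  rfl

/-- Almost everywhere statements may be checked on the images of the branches, because these cover
the space and the shift pulls null sets back to null sets. -/
theorem ae_of_ae_extend (hr : 2 ≤ r)
    (hlam : ∀ g : FreeGroup (Fin r), MeasurePreserving (fun x : X => g • x) lam lam)
    {Q : X × Boundary r → Prop} (h : ∀ j, ∀ᵐ p ∂lam.prod (boundaryMeasure r), Q (extend j p)) :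
    ∀ᵐ p ∂lam.prod (boundaryMeasure r), Q p := by
  filter_upwards [(measurePreserving_shift hr hlam).quasiMeasurePreserving.ae (ae_all_iff.2 h)]
    with p hp
  have := hp (index p)
  rwa [extend_index_shift] at this

/-- The action of a letter is nonsingular. -/
theorem ae_letter_smul (hr : 2 ≤ r)
    (hlam : ∀ g : FreeGroup (Fin r), MeasurePreserving (fun x : X => g • x) lam lam)
    (a : Letter r) {Q : X × Boundary r → Prop} (h : ∀ᵐ p ∂lam.prod (boundaryMeasure r), Q p) :
    ∀ᵐ p ∂lam.prod (boundaryMeasure r), Q ((FreeGroup.mk [a] : FreeGroup (Fin r)) • p) := by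
  filter_upwards [(measurePreserving_shift hr hlam).quasiMeasurePreserving.ae h,
    ae_all_iff.2 fun j => (quasiMeasurePreserving_extend hr hlam j).ae h] with p h1 h2
  rcases letter_smul_cases a p with h3 | ⟨j, h3⟩
  · rwa [h3]
  · rw [h3]
    exact h2 j

/-- The action of the group is nonsingular. -/
theorem ae_smul (hr : 2 ≤ r)
    (hlam : ∀ g : FreeGroup (Fin r), MeasurePreserving (fun x : X => g • x) lam lam)
    (g : FreeGroup (Fin r)) {Q : X × Boundary r → Prop}
    (h : ∀ᵐ p ∂lam.prod (boundaryMeasure r), Q p) :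
    ∀ᵐ p ∂lam.prod (boundaryMeasure r), Q (g • p) := by
  have key : ∀ (L : List (Letter r)) (Q : X × Boundary r → Prop),
      (∀ᵐ p ∂lam.prod (boundaryMeasure r), Q p) →
      ∀ᵐ p ∂lam.prod (boundaryMeasure r), Q ((FreeGroup.mk L : FreeGroup (Fin r)) • p) := by
    intro L
    induction L with
    | nil => simp [← FreeGroup.one_eq_mk]
    | cons a L ih =>
      intro Q hQ
      have h1 : (FreeGroup.mk (a :: L) : FreeGroup (Fin r)) =
          FreeGroup.mk [a] * FreeGroup.mk L := by
        rw [FreeGroup.mul_mk]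
        rfl
      simp only [h1, mul_smul]
      exact ih _ (ae_letter_smul hr hlam a hQ)
  rw [← FreeGroup.mk_toWord (x := g)]
  exact key _ Q h

end Invariance

/-! ### L² convergence for functions of the first letter -/

section FirstLetter

variable {r : ℕ} {X : Type*} [MulAction (FreeGroup (Fin r)) X]

/-- The transfer operator of the shift. -/
noncomputable def transfer (f : X × Boundary r → ℝ) (p : X × Boundary r) : ℝ :=
  ((2 * r - 1 : ℕ) : ℝ)⁻¹ * ∑ j, f (extend j p)

/-- The isometric involution on functions of the point of `X` and the first letter. -/
def flip (H : Letter r → X → ℝ) (c : Letter r) (x : X) : ℝ :=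
  H (invLetter c) ((FreeGroup.mk [c] : FreeGroup (Fin r))⁻¹ • x)

/-- The transfer operator on functions of the point of `X` and the first letter. -/
noncomputable def letterTransfer (H : Letter r → X → ℝ) (b : Letter r) (x : X) : ℝ :=
  ((2 * r - 1 : ℕ) : ℝ)⁻¹ * (∑ c, flip H c x - flip H b x)

/-- Inversion of letters as a permutation. -/
def invLetterPerm (r : ℕ) : Equiv.Perm (Letter r) :=
  Function.Involutive.toPerm invLetter invLetter_invLetter

/-- The letters that may precede b are all a ≠ b⁻¹. Substituting a = c⁻¹ turns their contributions
into `flip H c` with c ≠ b, that is, the full sum without the term at b. -/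
theorem transfer_firstLetter (H : Letter r → X → ℝ) :
    transfer (fun p : X × Boundary r => H (p.2.seq 0) p.1) =
      fun p => letterTransfer H (p.2.seq 0) p.1 := by
  funext p
  obtain ⟨x, ξ⟩ := p
  simp only [transfer, letterTransfer]
  congr 1
  set b := ξ.seq 0
  let F : Letter r → ℝ := fun a => H a ((FreeGroup.mk [a] : FreeGroup (Fin r)) • x)
  have hF : ∀ c, F (invLetter c) = flip H c x := fun c => by
    simp only [F, flip, mk_singleton_invLetter]
  have h1 : ∑ j, H ((extend j (x, ξ)).2.seq 0) (extend j (x, ξ)).1 =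
      ∑ a : {a : Letter r // a ≠ invLetter b}, F a :=
    Equiv.sum_comp (nextLetter b) fun a : {a : Letter r // a ≠ invLetter b} => F a
  have h2 : ∑ a : {a : Letter r // a ≠ invLetter b}, F a = ∑ a, F a - F (invLetter b) := by
    rw [← Finset.sum_subtype (Finset.univ.erase (invLetter b)) (by simp) F, eq_sub_iff_add_eq]
    exact Finset.sum_erase_add _ _ (Finset.mem_univ _)
  have h3 : ∑ c, flip H c x = ∑ a, F a := by
    simp only [← hF]
    exact Equiv.sum_comp (invLetterPerm r) F
  rw [h1, h2, h3, hF]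

theorem transfer_iterate_firstLetter (H : Letter r → X → ℝ) (n : ℕ) :
    transfer^[n] (fun p : X × Boundary r => H (p.2.seq 0) p.1) =
      fun p => letterTransfer^[n] H (p.2.seq 0) p.1 := by
  induction n with
  | zero => rfl
  | succ n ih => rw [Function.iterate_succ_apply', ih, transfer_firstLetter,
      Function.iterate_succ_apply']

theorem flip_flip (H : Letter r → X → ℝ) : flip (flip H) = H := by
  funext b x
  simp only [flip, invLetter_invLetter, mk_singleton_invLetter, inv_inv, smul_inv_smul]

theorem flip_sub (H K : Letter r → X → ℝ) : flip (H - K) = flip H - flip K := rfl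

/-- `letterTransfer` is `flip` followed by the matrix A with zero diagonal and all other entries
1/(2r-1). A is 1 on constants and λ = -1/(2r-1) on vectors of sum zero. The constant (r-1)/r =
(1+λ)/(1-λ) is the c that solves λ² + c(1-λ)² = 1, and for eigenvalue 1 the identity is trivial. -/
theorem sum_sq_letterTransfer (hr : 2 ≤ r) (H : Letter r → X → ℝ) (x : X) :
    ∑ b, letterTransfer H b x ^ 2 +
        ((r : ℝ) - 1) / r * ∑ b, (letterTransfer H b x - flip H b x) ^ 2 =
      ∑ b, flip H b x ^ 2 := by
  have hq : ((2 * r - 1 : ℕ) : ℝ) = 2 * r - 1 := by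
    rw [Nat.cast_sub (by omega)]
    push_cast
    ring
  have hr' : (2 : ℝ) ≤ r := by exact_mod_cast hr
  have hq0 : (2 * r - 1 : ℝ) ≠ 0 := by linarith
  have hr0 : (r : ℝ) ≠ 0 := by linarith
  simp only [letterTransfer, hq]
  generalize flip H = G
  set S := ∑ c, G c x with hS
  set Q := ∑ c, G c x ^ 2 with hQ
  have hcard : (Finset.univ : Finset (Letter r)).card = r * 2 := by simp
  have h1 : ∑ b, ((2 * r - 1 : ℝ)⁻¹ * (S - G b x)) ^ 2 =
      (2 * r - 1 : ℝ)⁻¹ ^ 2 * ((2 * r - 2) * S ^ 2 + Q) := by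
    have : ∀ b : Letter r, ((2 * r - 1 : ℝ)⁻¹ * (S - G b x)) ^ 2 =
        (2 * r - 1 : ℝ)⁻¹ ^ 2 * (S ^ 2 - 2 * S * G b x + G b x ^ 2) := fun b => by ring
    simp only [this]
    rw [← Finset.mul_sum, Finset.sum_add_distrib, Finset.sum_sub_distrib, ← Finset.mul_sum, ← hS,
      ← hQ, Finset.sum_const, hcard, nsmul_eq_mul]
    push_cast
    ring
  have h2 : ∑ b, ((2 * r - 1 : ℝ)⁻¹ * (S - G b x) - G b x) ^ 2 =
      (2 * r - 1 : ℝ)⁻¹ ^ 2 * (4 * r ^ 2 * Q - 2 * r * S ^ 2) := by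
    have : ∀ b : Letter r, ((2 * r - 1 : ℝ)⁻¹ * (S - G b x) - G b x) ^ 2 =
        (2 * r - 1 : ℝ)⁻¹ ^ 2 * (S ^ 2 - 4 * r * S * G b x + 4 * r ^ 2 * G b x ^ 2) := fun b => by
      field_simp
      ring
    simp only [this]
    rw [← Finset.mul_sum, Finset.sum_add_distrib, Finset.sum_sub_distrib, ← Finset.mul_sum,
      ← Finset.mul_sum, ← hS, ← hQ, Finset.sum_const, hcard, nsmul_eq_mul]
    push_cast
    ring
  rw [h1, h2]
  field_simp
  ring

variable [MeasurableSpace X] (lam : Measure X)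

/-- The squared norm of a function of the point of `X` and the first letter. -/
noncomputable def energy (H : Letter r → X → ℝ) : ℝ := ∑ b, ∫ x, H b x ^ 2 ∂lam

omit [MulAction (FreeGroup (Fin r)) X] in
theorem energy_nonneg (H : Letter r → X → ℝ) : 0 ≤ energy lam H :=
  Finset.sum_nonneg fun _ _ => integral_nonneg fun _ => sq_nonneg _

variable {lam} (hlam : ∀ g : FreeGroup (Fin r), MeasurePreserving (fun x : X => g • x) lam lam)

include hlam

theorem memLp_flip {H : Letter r → X → ℝ} (hH : ∀ b, MemLp (H b) 2 lam) (b : Letter r) :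
    MemLp (flip H b) 2 lam :=
  (hH (invLetter b)).comp_measurePreserving (hlam _)

theorem memLp_letterTransfer {H : Letter r → X → ℝ} (hH : ∀ b, MemLp (H b) 2 lam)
    (b : Letter r) : MemLp (letterTransfer H b) 2 lam :=
  ((memLp_finsetSum Finset.univ fun c _ => memLp_flip hlam hH c).sub
    (memLp_flip hlam hH b)).const_mul _

theorem memLp_letterTransfer_iterate {H : Letter r → X → ℝ} (hH : ∀ b, MemLp (H b) 2 lam) (n : ℕ)
    (b : Letter r) : MemLp (letterTransfer^[n] H b) 2 lam := by
  induction n generalizing b with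
  | zero => exact hH b
  | succ n ih =>
    rw [Function.iterate_succ_apply']
    exact memLp_letterTransfer hlam ih b

theorem energy_flip {H : Letter r → X → ℝ} (hH : ∀ b, MemLp (H b) 2 lam) :
    energy lam (flip H) = energy lam H := by
  have h1 : ∀ c, ∫ x, flip H c x ^ 2 ∂lam = ∫ x, H (invLetter c) x ^ 2 ∂lam := fun c => by
    have hp := hlam (FreeGroup.mk [c] : FreeGroup (Fin r))⁻¹
    have hm : AEStronglyMeasurable (fun x => H (invLetter c) x ^ 2)
        (lam.map fun x => (FreeGroup.mk [c] : FreeGroup (Fin r))⁻¹ • x) := by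
      rw [hp.map_eq]
      exact (hH _).1.pow 2
    have h2 := integral_map hp.measurable.aemeasurable hm
    rw [hp.map_eq] at h2
    exact h2.symm
  simp only [energy, h1]
  exact Equiv.sum_comp (invLetterPerm r) fun c => ∫ x, H c x ^ 2 ∂lam

theorem energy_letterTransfer (hr : 2 ≤ r) {H : Letter r → X → ℝ}
    (hH : ∀ b, MemLp (H b) 2 lam) :
    energy lam (letterTransfer H) +
        ((r : ℝ) - 1) / r * energy lam (letterTransfer H - flip H) = energy lam H := by
  have hT := memLp_letterTransfer hlam hH
  have hF := memLp_flip hlam hH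
  have hD : ∀ b, MemLp ((letterTransfer H - flip H) b) 2 lam := fun b => (hT b).sub (hF b)
  rw [← energy_flip hlam hH]
  simp only [energy]
  rw [← integral_finsetSum _ fun b _ => (hT b).integrable_sq,
    ← integral_finsetSum _ fun b _ => (hD b).integrable_sq,
    ← integral_finsetSum _ fun b _ => (hF b).integrable_sq, ← integral_const_mul,
    ← integral_add (integrable_finsetSum _ fun b _ => (hT b).integrable_sq)
      ((integrable_finsetSum _ fun b _ => (hD b).integrable_sq).const_mul _)]
  exact integral_congr_ae (ae_of_all _ fun x => sum_sq_letterTransfer hr H x)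

/-- By `energy_letterTransfer` these quantities are, up to a positive factor, the successive
decrements of a decreasing sequence bounded below by 0. -/
theorem tendsto_energy_sub_flip (hr : 2 ≤ r) {H : Letter r → X → ℝ}
    (hH : ∀ b, MemLp (H b) 2 lam) :
    Tendsto (fun n => energy lam (letterTransfer^[n + 1] H - flip (letterTransfer^[n] H)))
      atTop (𝓝 0) := by
  have hr' : (2 : ℝ) ≤ r := by exact_mod_cast hr
  have hc : 0 < ((r : ℝ) - 1) / r := div_pos (by linarith) (by linarith)
  set c := ((r : ℝ) - 1) / r
  have hid : ∀ n, energy lam (letterTransfer^[n + 1] H) +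
      c * energy lam (letterTransfer^[n + 1] H - flip (letterTransfer^[n] H)) =
      energy lam (letterTransfer^[n] H) := fun n => by
    rw [Function.iterate_succ_apply']
    exact energy_letterTransfer hlam hr (memLp_letterTransfer_iterate hlam hH n)
  have hanti : Antitone fun n => energy lam (letterTransfer^[n] H) :=
    antitone_nat_of_succ_le fun n => by
      rw [← hid n]
      exact le_add_of_nonneg_right (mul_nonneg hc.le (energy_nonneg _ _))
  have hlim := tendsto_atTop_ciInf hanti
    ⟨0, by rintro _ ⟨n, rfl⟩; exact energy_nonneg lam (letterTransfer^[n] H)⟩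
  have h := (hlim.sub (hlim.comp (tendsto_add_atTop_nat 1))).const_mul c⁻¹
  rw [sub_self, mul_zero] at h
  refine h.congr fun n => ?_
  rw [Function.comp_apply, ← hid n, add_sub_cancel_left, inv_mul_cancel_left₀ hc.ne']

omit hlam [MulAction (FreeGroup (Fin r)) X] in
theorem energy_add_le {H K : Letter r → X → ℝ} (hH : ∀ b, MemLp (H b) 2 lam)
    (hK : ∀ b, MemLp (K b) 2 lam) :
    energy lam (H + K) ≤ 2 * energy lam H + 2 * energy lam K := by
  simp only [energy, Finset.mul_sum, ← Finset.sum_add_distrib]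
  refine Finset.sum_le_sum fun b _ => ?_
  rw [← integral_const_mul, ← integral_const_mul,
    ← integral_add ((hH b).integrable_sq.const_mul 2) ((hK b).integrable_sq.const_mul 2)]
  refine integral_mono ((hH b).add (hK b)).integrable_sq
    (((hH b).integrable_sq.const_mul 2).add ((hK b).integrable_sq.const_mul 2)) fun x => ?_
  change (H b x + K b x) ^ 2 ≤ 2 * H b x ^ 2 + 2 * K b x ^ 2
  nlinarith [sq_nonneg (H b x - K b x)]

theorem tendsto_energy_sub (hr : 2 ≤ r) {H : Letter r → X → ℝ} (hH : ∀ b, MemLp (H b) 2 lam) :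
    Tendsto (fun n => energy lam (letterTransfer^[n + 2] H - letterTransfer^[n] H))
      atTop (𝓝 0) := by
  have h := tendsto_energy_sub_flip hlam hr hH
  have h2 := ((h.comp (tendsto_add_atTop_nat 1)).const_mul 2).add (h.const_mul 2)
  rw [mul_zero, add_zero] at h2
  refine squeeze_zero (fun n => energy_nonneg _ _) (fun n => ?_) h2
  have hI := memLp_letterTransfer_iterate hlam hH
  have hD : ∀ n b, MemLp ((letterTransfer^[n + 1] H - flip (letterTransfer^[n] H)) b) 2 lam :=
    fun n b => (hI _ b).sub (memLp_flip hlam (hI n) b)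
  -- As `flip` is an involution, the two intermediate terms `flip (letterTransfer^[n + 1] H)` cancel
  -- and `flip` of the last term returns the n-th iterate.
  have hsplit : letterTransfer^[n + 2] H - letterTransfer^[n] H =
      (letterTransfer^[n + 1 + 1] H - flip (letterTransfer^[n + 1] H)) +
        flip (letterTransfer^[n + 1] H - flip (letterTransfer^[n] H)) := by
    rw [flip_sub, flip_flip, sub_add_sub_cancel]
  rw [hsplit, Function.comp_apply, ← energy_flip hlam (hD n)]
  exact energy_add_le (hD (n + 1)) (memLp_flip hlam (hD n))

omit hlam [MulAction (FreeGroup (Fin r)) X] in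
theorem integral_abs_le_sqrt_energy [IsProbabilityMeasure lam] {H : Letter r → X → ℝ}
    (hH : ∀ b, MemLp (H b) 2 lam) (b : Letter r) :
    ∫ x, |H b x| ∂lam ≤ √(energy lam H) := by
  refine Real.le_sqrt_of_sq_le ?_
  have h1 : MemLp (fun x => |H b x|) 2 lam := (hH b).norm
  -- Nonnegativity of the variance serves as the Cauchy–Schwarz inequality (∫|H|)² ≤ ∫H².
  have h2 := ProbabilityTheory.variance_nonneg (fun x => |H b x|) lam
  rw [ProbabilityTheory.variance_eq_sub h1, sub_nonneg] at h2
  refine h2.trans ?_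
  have h3 : ∫ x, ((fun x => |H b x|) ^ 2) x ∂lam = ∫ x, H b x ^ 2 ∂lam := by simp
  rw [h3]
  exact Finset.single_le_sum (f := fun b => ∫ x, H b x ^ 2 ∂lam)
    (fun _ _ => integral_nonneg fun _ => sq_nonneg _) (Finset.mem_univ b)

omit [MulAction (FreeGroup (Fin r)) X] hlam in
theorem lintegral_firstLetter_le [IsProbabilityMeasure lam] (hr : 2 ≤ r) {H : Letter r → X → ℝ}
    (hH : ∀ b, MemLp (H b) 2 lam) :
    ∫⁻ p, ‖H (p.2.seq 0) p.1‖ₑ ∂lam.prod (boundaryMeasure r) ≤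
      ∑ _b : Letter r, ENNReal.ofReal √(energy lam H) := by
  have := isProbabilityMeasure_boundaryMeasure hr
  calc ∫⁻ p, ‖H (p.2.seq 0) p.1‖ₑ ∂lam.prod (boundaryMeasure r)
      ≤ ∫⁻ p, (∑ b, ‖H b p.1‖ₑ) ∂lam.prod (boundaryMeasure r) :=
        lintegral_mono fun p => Finset.single_le_sum (f := fun b => ‖H b p.1‖ₑ)
          (fun _ _ => zero_le) (Finset.mem_univ (p.2.seq 0))
    _ = ∫⁻ x, (∑ b, ‖H b x‖ₑ) ∂lam := by
        have hm : AEMeasurable (fun x => ∑ b, ‖H b x‖ₑ) lam :=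
          Finset.aemeasurable_fun_sum _ fun b _ => (hH b).1.enorm
        have := (measurePreserving_fst (μ := lam) (ν := boundaryMeasure r)).map_eq
        conv_rhs => rw [← this]
        rw [lintegral_map' (this.symm ▸ hm) measurable_fst.aemeasurable]
    _ = ∑ b, ∫⁻ x, ‖H b x‖ₑ ∂lam := lintegral_finsetSum' _ fun b _ => (hH b).1.enorm
    _ ≤ _ := Finset.sum_le_sum fun b _ => by
        rw [← ofReal_integral_norm_eq_lintegral_enorm ((hH b).integrable one_le_two)]
        exact ENNReal.ofReal_le_ofReal (integral_abs_le_sqrt_energy hH b)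

theorem tendsto_lintegral_transfer_sub_firstLetter [IsProbabilityMeasure lam] (hr : 2 ≤ r)
    {H : Letter r → X → ℝ} (hH : ∀ b, MemLp (H b) 2 lam) :
    Tendsto (fun n => ∫⁻ p, ‖transfer^[n + 2] (fun p => H (p.2.seq 0) p.1) p -
        transfer^[n] (fun p => H (p.2.seq 0) p.1) p‖ₑ ∂lam.prod (boundaryMeasure r))
      atTop (𝓝 0) := by
  have hlim : Tendsto (fun n => ∑ _b : Letter r, ENNReal.ofReal
      √(energy lam (letterTransfer^[n + 2] H - letterTransfer^[n] H))) atTop (𝓝 0) := by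
    have h1 := ENNReal.tendsto_ofReal
      ((Real.continuous_sqrt.tendsto 0).comp (tendsto_energy_sub hlam hr hH))
    have h2 := tendsto_finsetSum (Finset.univ : Finset (Letter r)) fun _ _ => h1
    simpa using h2
  refine tendsto_of_tendsto_of_tendsto_of_le_of_le tendsto_const_nhds hlim (fun _ => zero_le)
    fun n => ?_
  simp only [transfer_iterate_firstLetter]
  exact lintegral_firstLetter_le hr (H := letterTransfer^[n + 2] H - letterTransfer^[n] H)
    fun b => (memLp_letterTransfer_iterate hlam hH _ b).sub
      (memLp_letterTransfer_iterate hlam hH n b)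

end FirstLetter

/-! ### Functions of finitely many letters: density and reduction to one letter -/

section CylinderFunctions

variable {r : ℕ} {X : Type*}

/-- Functions on the product that depend on the point of `X` and the first `k` letters. -/
def DependsOnLetters {β : Type*} (k : ℕ) (g : X × Boundary r → β) : Prop :=
  ∀ x ξ η, (∀ i < k, ξ.seq i = η.seq i) → g (x, ξ) = g (x, η)

theorem DependsOnLetters.mono {β : Type*} {k l : ℕ} (hkl : k ≤ l) {g : X × Boundary r → β}
    (hg : DependsOnLetters k g) : DependsOnLetters l g :=
  fun x ξ η h => hg x ξ η fun i hi => h i (hi.trans_le hkl)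

/-- The bounded measurable functions that depend on finitely many letters. -/
def IsCylinderFunction [MeasurableSpace X] (g : X × Boundary r → ℝ) : Prop :=
  Measurable g ∧ (∃ C, ∀ p, |g p| ≤ C) ∧ ∃ k, DependsOnLetters k g

/-- The algebra of the measurable sets that depend on finitely many letters. -/
def cylinderAlgebra (r : ℕ) (X : Type*) [MeasurableSpace X] : Set (Set (X × Boundary r)) :=
  {E | MeasurableSet E ∧ ∃ k, DependsOnLetters k (· ∈ E)}

/-- The constant sequence. -/
def constBoundary (a : Letter r) : Boundary r :=
  ⟨fun _ => a, fun _ h => by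
    have := congrArg Prod.snd h
    simp [invLetter] at this⟩

variable [MeasurableSpace X]

theorem isSetAlgebra_cylinderAlgebra : IsSetAlgebra (cylinderAlgebra r X) where
  empty_mem := ⟨MeasurableSet.empty, 0, fun _ _ _ _ => rfl⟩
  compl_mem := by
    rintro E ⟨hE, k, h⟩
    exact ⟨hE.compl, k, fun x ξ η hi => congrArg Not (h x ξ η hi)⟩
  union_mem := by
    rintro E F ⟨hE, k, h⟩ ⟨hF, l, h'⟩
    exact ⟨hE.union hF, max k l, fun x ξ η hi => congrArg₂ Or
      (h.mono (le_max_left k l) x ξ η hi) (h'.mono (le_max_right k l) x ξ η hi)⟩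

theorem generateFrom_cylinderAlgebra :
    (inferInstance : MeasurableSpace (X × Boundary r)) =
      MeasurableSpace.generateFrom (cylinderAlgebra r X) := by
  refine le_antisymm (sup_le ?_ ?_) (MeasurableSpace.generateFrom_le fun E hE => hE.1)
  · rintro _ ⟨A, hA, rfl⟩
    exact MeasurableSpace.measurableSet_generateFrom
      ⟨measurable_fst hA, 0, fun _ _ _ _ => rfl⟩
  · suffices hm : @Measurable _ _ (MeasurableSpace.generateFrom (cylinderAlgebra r X)) _
        (Prod.snd : X × Boundary r → Boundary r) from hm.comap_le
    refine (@measurable_boundary_iff r _ (MeasurableSpace.generateFrom (cylinderAlgebra r X)) _).2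
      fun i => ?_
    refine @measurable_to_countable' _ _ _ _
      (MeasurableSpace.generateFrom (cylinderAlgebra r X)) _ fun a => ?_
    refine MeasurableSpace.measurableSet_generateFrom
      ⟨((measurable_seq i).comp measurable_snd) (MeasurableSet.singleton a), i + 1, ?_⟩
    intro x ξ η h
    change (ξ.seq i = a) = (η.seq i = a)
    rw [h i (Nat.lt_succ_self i)]

/-- Sets depending on finitely many letters form an algebra generating the σ-algebra, so they
approximate every measurable set in measure. Passing from indicators to their sums yields density in
L¹. -/
theorem exists_isCylinderFunction_eLpNorm_sub_le {μ : Measure (X × Boundary r)}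
    [IsFiniteMeasure μ] {f : X × Boundary r → ℝ} (hf : Integrable f μ) {ε : ENNReal}
    (hε : ε ≠ 0) : ∃ g, eLpNorm (f - g) 1 μ ≤ ε ∧ IsCylinderFunction g := by
  refine MemLp.induction_dense ENNReal.one_ne_top IsCylinderFunction ?_ ?_ ?_
    (memLp_one_iff_integrable.2 hf) hε
  · intro c s hs _ ε hε
    obtain ⟨δ, hδ, h⟩ := exists_eLpNorm_indicator_le (μ := μ) ENNReal.one_ne_top c hε
    obtain ⟨t, ⟨htm, k, ht⟩, hst⟩ :=
      (Measure.MeasureDense.of_generateFrom_isSetAlgebra_finite μ isSetAlgebra_cylinderAlgebra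
        generateFrom_cylinderAlgebra).approx s hs (measure_ne_top μ s) δ (by exact_mod_cast hδ)
    refine ⟨t.indicator fun _ => c, ?_, measurable_const.indicator htm, ⟨|c|, fun p => ?_⟩,
      k, fun x ξ η hi => ?_⟩
    · rw [eLpNorm_indicator_sub_indicator]
      refine h _ ?_
      rw [symmDiff_comm]
      simpa using hst.le
    · by_cases hp : p ∈ t <;> simp [hp]
    · have := ht x ξ η hi
      by_cases hp : (x, ξ) ∈ t
      · rw [Set.indicator_of_mem hp, Set.indicator_of_mem (this.mp hp)]
      · rw [Set.indicator_of_notMem hp, Set.indicator_of_notMem fun h => hp (this.mpr h)]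
  · rintro g₁ g₂ ⟨hm, ⟨C, hC⟩, k, hk⟩ ⟨hm', ⟨C', hC'⟩, k', hk'⟩
    refine ⟨hm.add hm', ⟨C + C', fun p => (abs_add_le _ _).trans (add_le_add (hC p) (hC' p))⟩,
      max k k', fun x ξ η hi => ?_⟩
    exact congrArg₂ (· + ·) (hk.mono (le_max_left k k') x ξ η hi)
      (hk'.mono (le_max_right k k') x ξ η hi)
  · exact fun g hg => hg.1.aestronglyMeasurable

variable [MulAction (FreeGroup (Fin r)) X]

-- A branch puts one letter in front and chooses it from the first letter alone, so k + 2 letters of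
-- the extended sequence are determined by k + 1 letters of the original. The first letter can never
-- be dropped, which is why the process stops at one letter.
omit [MeasurableSpace X] in
theorem DependsOnLetters.transfer {k : ℕ} {g : X × Boundary r → ℝ}
    (hg : DependsOnLetters (k + 2) g) : DependsOnLetters (k + 1) (transfer g) := by
  intro x ξ η h
  have h0 : ξ.seq 0 = η.seq 0 := h 0 (by omega)
  refine congrArg (((2 * r - 1 : ℕ) : ℝ)⁻¹ * ·) (Finset.sum_congr rfl fun j _ => ?_)
  have h1 : (extend j (x, ξ)).1 = (extend j (x, η)).1  :=
    congrArg (fun b : Letter r => (FreeGroup.mk [(nextLetter b j).1] : FreeGroup (Fin r)) • x) h0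
  calc g (extend j (x, ξ)) = g ((extend j (x, ξ)).1, (extend j (x, ξ)).2) := rfl
    _ = g ((extend j (x, η)).1, (extend j (x, ξ)).2) := by rw [h1]
    _ = g ((extend j (x, η)).1, (extend j (x, η)).2) := by
        refine hg _ _ _ fun i hi => ?_
        cases i with
        | zero =>
          change (nextLetter (ξ.seq 0) j).1 = (nextLetter (η.seq 0) j).1
          rw [h0]
        | succ i => exact h i (by omega)

omit [MeasurableSpace X] in
theorem DependsOnLetters.transfer_iterate {k : ℕ} {g : X × Boundary r → ℝ}
    (hg : DependsOnLetters (k + 1) g) :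
    DependsOnLetters 1 (FreeGroupBoundary.transfer^[k] g) := by
  induction k generalizing g with
  | zero => exact hg
  | succ k ih => exact ih hg.transfer

theorem measurable_transfer (hX : ∀ g : FreeGroup (Fin r), Measurable fun x : X => g • x)
    {g : X × Boundary r → ℝ} (hg : Measurable g) : Measurable (transfer g) :=
  (Finset.measurable_fun_sum _ fun j _ => hg.comp (measurable_extend_apply hX j)).const_mul _

omit [MeasurableSpace X] in
theorem abs_transfer_le (hr : 2 ≤ r) {g : X × Boundary r → ℝ} {C : ℝ} (hg : ∀ p, |g p| ≤ C)
    (p : X × Boundary r) : |transfer g p| ≤ C := by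
  have hq : (0 : ℝ) < ((2 * r - 1 : ℕ) : ℝ) := by
    rw [Nat.cast_pos]
    omega
  rw [transfer, abs_mul, abs_of_pos (inv_pos.2 hq), inv_mul_le_iff₀ hq]
  refine (Finset.abs_sum_le_sum_abs _ _).trans ?_
  refine (Finset.sum_le_sum fun j _ => hg (extend j p)).trans_eq ?_
  simp

theorem tendsto_lintegral_transfer_sub_of_isCylinderFunction {lam : Measure X}
    [IsProbabilityMeasure lam] (hr : 2 ≤ r)
    (hlam : ∀ g : FreeGroup (Fin r), MeasurePreserving (fun x : X => g • x) lam lam)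
    {g : X × Boundary r → ℝ} (hg : IsCylinderFunction g) :
    Tendsto (fun n => ∫⁻ p, ‖transfer^[n + 2] g p - transfer^[n] g p‖ₑ
      ∂lam.prod (boundaryMeasure r)) atTop (𝓝 0) := by
  obtain ⟨hm, ⟨C, hC⟩, k, hk⟩ := hg
  have hX := fun g => (hlam g).measurable
  have h1 : ∀ n, Measurable (transfer^[n] g) ∧ ∀ p, |transfer^[n] g p| ≤ C := by
    intro n
    induction n with
    | zero => exact ⟨hm, hC⟩
    | succ n ih =>
      rw [Function.iterate_succ_apply']
      exact ⟨measurable_transfer hX ih.1, abs_transfer_le hr ih.2⟩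
  have h2 := (hk.mono (Nat.le_succ k)).transfer_iterate
  -- After k transfers only the first letter matters, so the constant sequence may represent every
  -- sequence with that first letter.
  let H : Letter r → X → ℝ := fun a x => transfer^[k] g (x, constBoundary a)
  have hH : transfer^[k] g = fun p => H (p.2.seq 0) p.1 := by
    funext p
    refine h2 p.1 p.2 (constBoundary (p.2.seq 0)) fun i hi => ?_
    obtain rfl : i = 0 := by omega
    rfl
  have hL : ∀ b, MemLp (H b) 2 lam := fun b =>
    MemLp.of_bound ((h1 k).1.comp measurable_prodMk_right).aestronglyMeasurable C
      (ae_of_all _ fun x => (h1 k).2 _)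
  have h3 := tendsto_lintegral_transfer_sub_firstLetter hlam hr hL
  rw [← hH] at h3
  rw [← tendsto_add_atTop_iff_nat k]
  refine h3.congr fun n => ?_
  rw [← Function.iterate_add_apply, ← Function.iterate_add_apply, add_right_comm]

end CylinderFunctions

/-! ### L¹ contraction and convergence for integrable functions -/

section Contraction

variable {r : ℕ} {X : Type*} [MulAction (FreeGroup (Fin r)) X]

theorem transfer_iterate_sub (f g : X × Boundary r → ℝ) (n : ℕ) :
    transfer^[n] (f - g) = transfer^[n] f - transfer^[n] g := by
  induction n generalizing f g with
  | zero => rfl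
  | succ n ih =>
    have h : transfer (f - g) = transfer f - transfer g := by
      funext p
      simp only [transfer, Pi.sub_apply, Finset.sum_sub_distrib, mul_sub]
    rw [Function.iterate_succ_apply, h, ih]
    rfl

variable [MeasurableSpace X] {lam : Measure X} [IsProbabilityMeasure lam] (hr : 2 ≤ r)
  (hlam : ∀ g : FreeGroup (Fin r), MeasurePreserving (fun x : X => g • x) lam lam)

include hr hlam

theorem mul_lintegral_eq_sum_extend₀ {f : X × Boundary r → ENNReal}
    (hf : AEMeasurable f (lam.prod (boundaryMeasure r))) :
    ((2 * r - 1 : ℕ) : ENNReal) * ∫⁻ p, f p ∂lam.prod (boundaryMeasure r) =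
      ∑ j, ∫⁻ p, f (extend j p) ∂lam.prod (boundaryMeasure r) := by
  rw [lintegral_congr_ae hf.ae_eq_mk, mul_lintegral_eq_sum_extend hr hlam hf.measurable_mk]
  exact Finset.sum_congr rfl fun j _ => lintegral_congr_ae
    ((quasiMeasurePreserving_extend hr hlam j).ae_eq_comp hf.ae_eq_mk.symm)

theorem aemeasurable_transfer_iterate {f : X × Boundary r → ℝ}
    (hf : AEMeasurable f (lam.prod (boundaryMeasure r))) (n : ℕ) :
    AEMeasurable (transfer^[n] f) (lam.prod (boundaryMeasure r)) := by
  induction n generalizing f with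
  | zero => exact hf
  | succ n ih =>
    exact ih ((Finset.aemeasurable_fun_sum _ fun j _ => hf.comp_quasiMeasurePreserving
      (quasiMeasurePreserving_extend hr hlam j)).const_mul _)

/-- The triangle inequality bounds |Tf| by the average of |f| over the branches, whose integral is
that of |f|. -/
theorem lintegral_transfer_iterate_le {f : X × Boundary r → ℝ}
    (hf : AEMeasurable f (lam.prod (boundaryMeasure r))) (n : ℕ) :
    ∫⁻ p, ‖transfer^[n] f p‖ₑ ∂lam.prod (boundaryMeasure r) ≤
      ∫⁻ p, ‖f p‖ₑ ∂lam.prod (boundaryMeasure r) := by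
  induction n generalizing f with
  | zero => exact le_rfl
  | succ n ih =>
    refine (ih (aemeasurable_transfer_iterate hr hlam hf 1)).trans ?_
    have hq0 : ((2 * r - 1 : ℕ) : ENNReal) ≠ 0 := by
      rw [Ne, Nat.cast_eq_zero]
      omega
    refine (ENNReal.mul_le_mul_iff_right hq0 (ENNReal.natCast_ne_top _)).1 ?_
    rw [mul_lintegral_eq_sum_extend₀ hr hlam hf.enorm,
      ← lintegral_const_mul' _ _ (ENNReal.natCast_ne_top _),
      ← lintegral_finsetSum' (f := fun j p => ‖f (extend j p)‖ₑ) _ fun j _ =>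
        hf.enorm.comp_quasiMeasurePreserving (quasiMeasurePreserving_extend hr hlam j)]
    refine lintegral_mono fun p => ?_
    have h1 : ((2 * r - 1 : ℕ) : ENNReal) = ‖((2 * r - 1 : ℕ) : ℝ)‖ₑ := by
      rw [Real.enorm_natCast]
    have hq : ((2 * r - 1 : ℕ) : ℝ) ≠ 0 := by
      rw [Ne, Nat.cast_eq_zero]
      omega
    rw [h1, ← enorm_mul, Function.iterate_one, transfer, mul_inv_cancel_left₀ hq]
    exact enorm_sum_le _ _

theorem tendsto_lintegral_transfer_sub {f : X × Boundary r → ℝ}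
    (hf : Integrable f (lam.prod (boundaryMeasure r))) :
    Tendsto (fun n => ∫⁻ p, ‖transfer^[n + 2] f p - transfer^[n] f p‖ₑ
      ∂lam.prod (boundaryMeasure r)) atTop (𝓝 0) := by
  have := isProbabilityMeasure_boundaryMeasure hr
  refine ENNReal.tendsto_nhds_zero.2 fun ε hε => ?_
  have hε3 : ε / 3 ≠ 0 := (ENNReal.div_pos hε.ne' (by simp)).ne'
  obtain ⟨g, hfg, hg⟩ := exists_isCylinderFunction_eLpNorm_sub_le hf hε3
  rw [eLpNorm_one_eq_lintegral_enorm] at hfg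
  have hgt := tendsto_lintegral_transfer_sub_of_isCylinderFunction hr hlam hg
  filter_upwards [ENNReal.tendsto_nhds_zero.1 hgt (ε / 3) (pos_iff_ne_zero.2 hε3)] with n hn
  have hm : AEMeasurable (f - g) (lam.prod (boundaryMeasure r)) :=
    hf.1.aemeasurable.sub hg.1.aemeasurable
  have h1 := fun k => (lintegral_transfer_iterate_le hr hlam hm k).trans hfg
  -- Of the three errors, the two involving f - g are at most ε/3 for every n by contraction, and
  -- the third is small for large n because g is a cylinder function.
  have hpt : ∀ p, ‖transfer^[n + 2] f p - transfer^[n] f p‖ₑ ≤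
      ‖transfer^[n + 2] (f - g) p‖ₑ + (‖transfer^[n] (f - g) p‖ₑ +
        ‖transfer^[n + 2] g p - transfer^[n] g p‖ₑ) := by
    intro p
    have : transfer^[n + 2] f p - transfer^[n] f p = transfer^[n + 2] (f - g) p +
        (-transfer^[n] (f - g) p + (transfer^[n + 2] g p - transfer^[n] g p)) := by
      rw [transfer_iterate_sub, transfer_iterate_sub]
      simp only [Pi.sub_apply]
      ring
    rw [this]
    refine (enorm_add_le _ _).trans (add_le_add_right ((enorm_add_le _ _).trans_eq ?_) _)
    rw [enorm_neg]
  refine (lintegral_mono hpt).trans ?_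
  rw [lintegral_add_left' (aemeasurable_transfer_iterate hr hlam hm _).enorm,
    lintegral_add_left' (aemeasurable_transfer_iterate hr hlam hm _).enorm]
  refine (add_le_add (h1 _) (add_le_add (h1 _) hn)).trans_eq ?_
  rw [← add_assoc, ENNReal.add_thirds]

end Contraction

/-! ### Tail invariance, invariance under the squared shift, and the even subgroup -/

section TailInvariance

variable {r : ℕ} {X : Type*} [MulAction (FreeGroup (Fin r)) X] [MeasurableSpace X]

/-- Almost everywhere invariance under the Borel automorphisms that preserve some iterate of the
shift at each point. -/
def IsTailInvariant (μ : Measure (X × Boundary r)) (f : X × Boundary r → ℝ) : Prop :=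
  ∀ φ : (X × Boundary r) ≃ᵐ (X × Boundary r), (∀ p, ∃ n, shift^[n] (φ p) = shift^[n] p) →
    f ∘ φ =ᵐ[μ] f

/-- The automorphism that permutes the numbers of the first letters. -/
noncomputable def permuteFirst (hX : ∀ g : FreeGroup (Fin r), Measurable fun x : X => g • x)
    (σ : Equiv.Perm (Fin (2 * r - 1))) : (X × Boundary r) ≃ᵐ (X × Boundary r) where
  toFun p := extend (σ (index p)) (shift p)
  invFun p := extend (σ.symm (index p)) (shift p)
  left_inv p := by simp
  right_inv p := by simp
  measurable_toFun := by
    have h := (measurable_extend hX).comp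
      (((measurable_of_countable σ).comp measurable_index).prodMk (measurable_shift hX))
    exact h
  measurable_invFun := by
    have h := (measurable_extend hX).comp
      (((measurable_of_countable σ.symm).comp measurable_index).prodMk (measurable_shift hX))
    exact h

/-- The lift of an automorphism through the shift that keeps the number of the first letter. -/
noncomputable def liftThroughShift
    (hX : ∀ g : FreeGroup (Fin r), Measurable fun x : X => g • x)
    (φ : (X × Boundary r) ≃ᵐ (X × Boundary r)) : (X × Boundary r) ≃ᵐ (X × Boundary r) where
  toFun p := extend (index p) (φ (shift p))
  invFun p := extend (index p) (φ.symm (shift p))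
  left_inv p := by simp
  right_inv p := by simp
  measurable_toFun := by
    have h := (measurable_extend hX).comp
      (measurable_index.prodMk (φ.measurable.comp (measurable_shift hX)))
    exact h
  measurable_invFun := by
    have h := (measurable_extend hX).comp
      (measurable_index.prodMk (φ.symm.measurable.comp (measurable_shift hX)))
    exact h

variable {lam : Measure X} [IsProbabilityMeasure lam] (hr : 2 ≤ r)
  (hlam : ∀ g : FreeGroup (Fin r), MeasurePreserving (fun x : X => g • x) lam lam)

include hr hlam

/-- An automorphism φ lifts through the shift to one that commutes with every branch, in the sense
that it takes `extend j p` to `extend j (φ p)`. Invariance of f under the lift, read on each branch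
and averaged, is invariance of the transfer under φ. -/
theorem IsTailInvariant.transfer {f : X × Boundary r → ℝ}
    (hf : IsTailInvariant (lam.prod (boundaryMeasure r)) f) :
    IsTailInvariant (lam.prod (boundaryMeasure r)) (transfer f) := by
  intro φ hφ
  have hX := fun g => (hlam g).measurable
  have h1 := hf (liftThroughShift hX φ) fun p => by
    obtain ⟨n, hn⟩ := hφ (shift p)
    refine ⟨n + 1, ?_⟩
    change shift^[n] (shift (extend (index p) (φ (shift p)))) = shift^[n] (shift p)
    rw [shift_extend, hn]
  have h2 := fun j => (quasiMeasurePreserving_extend hr hlam j).ae h1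
  filter_upwards [ae_all_iff.2 h2] with p hp
  refine congrArg (((2 * r - 1 : ℕ) : ℝ)⁻¹ * ·) (Finset.sum_congr rfl fun j _ => ?_)
  have h3 := hp j
  change f (extend (index (extend j p)) (φ (shift (extend j p)))) = _ at h3
  rwa [index_extend, shift_extend] at h3

/-- Swapping two branches preserves the shift, so f takes a.e. the same value on all preimages of a
point and equals its average over them. -/
theorem IsTailInvariant.ae_eq_transfer_comp_shift {f : X × Boundary r → ℝ}
    (hf : IsTailInvariant (lam.prod (boundaryMeasure r)) f) :
    f =ᵐ[lam.prod (boundaryMeasure r)] FreeGroupBoundary.transfer f ∘ shift := by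
  have hX := fun g => (hlam g).measurable
  have h1 : ∀ i j, ∀ᵐ p ∂lam.prod (boundaryMeasure r), f (extend i p) = f (extend j p) := by
    intro i j
    have h2 := hf (permuteFirst hX (Equiv.swap j i)) fun p => ⟨1, shift_extend _ _⟩
    filter_upwards [(quasiMeasurePreserving_extend hr hlam j).ae h2] with p hp
    change f (extend (Equiv.swap j i (index (extend j p))) (shift (extend j p))) = _ at hp
    rwa [index_extend, shift_extend, Equiv.swap_apply_left] at hp
  refine ae_of_ae_extend hr hlam fun j => ?_
  filter_upwards [ae_all_iff.2 fun i => h1 i j] with p hp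
  have hq : ((2 * r - 1 : ℕ) : ℝ) ≠ 0 := by
    rw [Ne, Nat.cast_eq_zero]
    omega
  rw [Function.comp_apply, shift_extend, FreeGroupBoundary.transfer,
    Finset.sum_congr rfl fun i _ => hp i, Finset.sum_const, Finset.card_univ, Fintype.card_fin, nsmul_eq_mul, inv_mul_cancel_left₀ hq]

theorem IsTailInvariant.ae_eq_transfer_iterate {f : X × Boundary r → ℝ}
    (hf : IsTailInvariant (lam.prod (boundaryMeasure r)) f) (n : ℕ) :
    f =ᵐ[lam.prod (boundaryMeasure r)] FreeGroupBoundary.transfer^[n] f ∘ shift^[n] := by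
  induction n generalizing f with
  | zero => rfl
  | succ n ih =>
    have h1 := ih (hf.transfer hr hlam)
    have h2 := (measurePreserving_shift hr hlam).quasiMeasurePreserving.ae_eq_comp h1
    exact (hf.ae_eq_transfer_comp_shift hr hlam).trans h2

/-- Tail invariant functions are invariant under the square of the shift. -/
theorem IsTailInvariant.comp_shift_shift {f : X × Boundary r → ℝ}
    (hf : IsTailInvariant (lam.prod (boundaryMeasure r)) f)
    (hint : Integrable f (lam.prod (boundaryMeasure r))) :
    f ∘ shift^[2] =ᵐ[lam.prod (boundaryMeasure r)] f := by
  have hP := (measurePreserving_shift hr hlam).iterate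
  have hm : AEMeasurable f (lam.prod (boundaryMeasure r)) := hint.1.aemeasurable
  have hT := aemeasurable_transfer_iterate hr hlam hm
  -- Both terms are functions of the (n+2)-nd shift: f is T^(n+2) f composed with it, and f ∘ P² is
  -- T^n f ∘ P^n ∘ P². As the shift preserves the measure, it can be removed, and the left side does
  -- not depend on n.
  have key : ∀ n, ∫⁻ p, ‖f (shift^[2] p) - f p‖ₑ ∂lam.prod (boundaryMeasure r) =
      ∫⁻ p, ‖FreeGroupBoundary.transfer^[n + 2] f p - FreeGroupBoundary.transfer^[n] f p‖ₑ
        ∂lam.prod (boundaryMeasure r) := by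
    intro n
    have h1 := (hP 2).quasiMeasurePreserving.ae_eq_comp (hf.ae_eq_transfer_iterate hr hlam n)
    have h2 := hf.ae_eq_transfer_iterate hr hlam (n + 2)
    have h3 : AEMeasurable (fun p => ‖FreeGroupBoundary.transfer^[n + 2] f p -
        FreeGroupBoundary.transfer^[n] f p‖ₑ) (lam.prod (boundaryMeasure r)) :=
      ((hT (n + 2)).sub (hT n)).enorm
    conv_rhs => rw [← (hP (n + 2)).map_eq]
    rw [lintegral_map' ((hP (n + 2)).map_eq.symm ▸ h3) (hP (n + 2)).measurable.aemeasurable]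
    refine lintegral_congr_ae ?_
    filter_upwards [h1, h2] with p hp1 hp2
    rw [Function.comp_apply] at hp1
    rw [hp1, hp2, enorm_sub_rev, Function.comp_apply, Function.comp_apply,
      Function.comp_apply, ← Function.iterate_add_apply]
  have h0 : ∫⁻ p, ‖f (shift^[2] p) - f p‖ₑ ∂lam.prod (boundaryMeasure r) = 0 :=
    tendsto_nhds_unique (tendsto_const_nhds.congr key)
      (tendsto_lintegral_transfer_sub hr hlam hint)
  have hm2 : AEMeasurable (fun p => ‖f (shift^[2] p) - f p‖ₑ) (lam.prod (boundaryMeasure r)) :=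
    ((hm.comp_quasiMeasurePreserving (hP 2).quasiMeasurePreserving).sub hm).enorm
  rw [lintegral_eq_zero_iff' hm2] at h0
  filter_upwards [h0] with p hp
  exact sub_eq_zero.1 (enorm_eq_zero.1 hp)

/-- Sets that are invariant under the horospherical relation are almost invariant under the
elements of even length. -/
theorem ae_smul_mem_iff_of_horoRel_invariant {E : Set (X × Boundary r)} (hE : MeasurableSet E)
    (hinv : ∀ p q, horoRel p q → (p ∈ E ↔ q ∈ E)) {g : FreeGroup (Fin r)}
    (hg : g ∈ evenSubgroup r) :
    ∀ᵐ p ∂lam.prod (boundaryMeasure r), g • p ∈ E ↔ p ∈ E := by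
  have := isProbabilityMeasure_boundaryMeasure hr
  have hT : IsTailInvariant (lam.prod (boundaryMeasure r)) (E.indicator fun _ => 1) := by
    intro φ hφ
    refine ae_of_all _ fun p => ?_
    obtain ⟨n, hn⟩ := hφ p
    have h := hinv _ _ (horoRel_of_iterate_shift_eq hn)
    by_cases hp : p ∈ E
    · rw [Function.comp_apply, Set.indicator_of_mem hp, Set.indicator_of_mem (h.2 hp)]
    · rw [Function.comp_apply, Set.indicator_of_notMem hp, Set.indicator_of_notMem (mt h.1 hp)]
  have hZ : ∀ᵐ p ∂lam.prod (boundaryMeasure r), shift^[2] p ∈ E ↔ p ∈ E := by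
    filter_upwards [hT.comp_shift_shift hr hlam ((integrable_const 1).indicator hE)] with p hp
    rw [Function.comp_apply] at hp
    by_cases h1 : shift^[2] p ∈ E <;> by_cases h2 : p ∈ E <;> simp_all
  have hpair : ∀ a b : Letter r, ∀ᵐ p ∂lam.prod (boundaryMeasure r),
      (FreeGroup.mk [a] : FreeGroup (Fin r)) • (FreeGroup.mk [b] : FreeGroup (Fin r)) • p ∈ E ↔
        p ∈ E := by
    intro a b
    filter_upwards [hZ, ae_letter_smul hr hlam b (ae_letter_smul hr hlam a hZ)] with p h1 h2
    -- Two shifts give P². A shift followed by a branch yields a point with the same shift as p,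
    -- hence a related one. A branch followed by a shift gives back p. Two branches are undone by
    -- P², which is where its invariance is needed at the image point, supplied by nonsingularity.
    rcases letter_smul_cases b p with hb | ⟨j, hb⟩ <;>
      rcases letter_smul_cases a ((FreeGroup.mk [b] : FreeGroup (Fin r)) • p) with ha | ⟨k, ha⟩
    · rw [ha, hb]
      exact h1
    · refine hinv _ _ (horoRel_of_iterate_shift_eq (n := 1) ?_)
      rw [ha, Function.iterate_one, shift_extend, hb]
    · rw [ha, hb, shift_extend]
    · rw [← h2, ha, hb]
      simp
  have hlist : ∀ (n : ℕ) (L : List (Letter r)), L.length = 2 * n →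
      ∀ᵐ p ∂lam.prod (boundaryMeasure r), (FreeGroup.mk L : FreeGroup (Fin r)) • p ∈ E ↔ p ∈ E := by
    intro n
    induction n with
    | zero =>
      intro L hL
      obtain rfl := List.length_eq_zero_iff.1 hL
      simp [← FreeGroup.one_eq_mk]
    | succ n ih =>
      intro L hL
      match L, hL with
      | a :: b :: L, hL =>
        have h1 : (FreeGroup.mk (a :: b :: L) : FreeGroup (Fin r)) =
            FreeGroup.mk [a] * (FreeGroup.mk [b] * FreeGroup.mk L) := by
          rw [FreeGroup.mul_mk, FreeGroup.mul_mk]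
          rfl
        have hL' : L.length = 2 * n := by
          simp only [List.length_cons] at hL
          omega
        filter_upwards [ih L hL', ae_smul hr hlam (FreeGroup.mk L) (hpair a b)] with p h2 h3
        rw [h1, mul_smul, mul_smul, h3, h2]
  refine Subgroup.closure_induction (p := fun g _ =>
    ∀ᵐ p ∂lam.prod (boundaryMeasure r), g • p ∈ E ↔ p ∈ E) ?_ ?_ ?_ ?_ hg
  · intro g hg
    obtain ⟨n, hn⟩ := (hg : Even g.norm)
    have h := hlist n g.toWord (by rw [two_mul]; exact hn)
    rwa [FreeGroup.mk_toWord] at h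
  · simp
  · intro g h _ _ hg hh
    filter_upwards [hh, ae_smul hr hlam h hg] with p h1 h2
    rw [mul_smul, h2, h1]
  · intro g _ hg
    filter_upwards [ae_smul hr hlam g⁻¹ hg] with p hp
    rw [smul_inv_smul] at hp
    exact hp.symm

/-- A set that is invariant under the horospherical relation agrees almost everywhere with a set
that is invariant under the even subgroup. -/
theorem exists_ae_eq_measurableSet_groupInvariants {E : Set (X × Boundary r)}
    (hE : MeasurableSet[relInvariants (horoRel (r := r) (X := X))] E) :
    ∃ E', MeasurableSet[groupInvariants (evenSubgroup r) (X × Boundary r)] E' ∧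
      E' =ᵐ[lam.prod (boundaryMeasure r)] E := by
  obtain ⟨hEm, hinv⟩ := hE
  have hX := fun g => (hlam g).measurable
  have hmeas : ∀ g : FreeGroup (Fin r), Measurable fun p : X × Boundary r => g • p := fun g =>
    ((hX g).comp measurable_fst).prodMk ((measurable_boundary_smul g).comp measurable_snd)
  have hcount : Countable (FreeGroup (Fin r)) := FreeGroup.toWord_injective.countable
  -- The intersection of all translates is strictly invariant. Since the group is countable, it is
  -- measurable and differs from E by a null set.
  refine ⟨⋂ g : evenSubgroup r, (fun p => g • p) ⁻¹' E, ⟨?_, fun h => ?_⟩, ?_⟩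
  · exact MeasurableSet.iInter fun g => hmeas g hEm
  · ext p
    simp only [Set.mem_preimage, Set.mem_iInter]
    refine ⟨fun hp g => ?_, fun hp g => ?_⟩
    · have := hp (g * h⁻¹)
      rwa [smul_smul, inv_mul_cancel_right] at this
    · rw [smul_smul]
      exact hp (g * h)
  · have h := ae_all_iff.2 fun g : evenSubgroup r =>
      ae_smul_mem_iff_of_horoRel_invariant hr hlam hEm hinv g.2
    filter_upwards [h] with p hp
    refine propext ?_
    change p ∈ ⋂ g : evenSubgroup r, (fun p => g • p) ⁻¹' E ↔ p ∈ E
    simp only [Set.mem_preimage, Set.mem_iInter]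
    exact ⟨fun h1 => (hp 1).1 (h1 1), fun h1 g => (hp g).2 h1⟩

end TailInvariance

/-- Conditional expectations on two nested σ-algebras agree if these have the same sets up to null
sets. -/
theorem condExp_ae_eq_of_le_of_forall_exists {Ω E : Type*} [NormedAddCommGroup E]
    [NormedSpace ℝ E] [CompleteSpace E] {m₁ m₂ m₀ : MeasurableSpace Ω} {μ : Measure Ω}
    [IsFiniteMeasure μ] (h12 : m₁ ≤ m₂) (h2 : m₂ ≤ m₀)
    (h : ∀ s, MeasurableSet[m₂] s → ∃ t, MeasurableSet[m₁] t ∧ t =ᵐ[μ] s) {f : Ω → E}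
    (hf : Integrable f μ) : μ[f | m₁] =ᵐ[μ] μ[f | m₂] := by
  refine ae_eq_condExp_of_forall_setIntegral_eq h2 hf
    (fun s _ _ => integrable_condExp.integrableOn) (fun s hs _ => ?_)
    (stronglyMeasurable_condExp.mono h12).aestronglyMeasurable
  obtain ⟨t, ht, hts⟩ := h s hs
  rw [← setIntegral_congr_set hts, ← setIntegral_congr_set hts,
    setIntegral_condExp (h12.trans h2) hf ht]

end FreeGroupBoundary

open FreeGroupBoundary in
theorem theorem5p2 {r : ℕ} (hr : 2 ≤ r) {X : Type*} [MeasurableSpace X] [StandardBorelSpace X]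
    [MulAction (FreeGroup (Fin r)) X] (lam : Measure X) [IsProbabilityMeasure lam]
    (hlam : ∀ g : FreeGroup (Fin r), MeasurePreserving (fun x : X => g • x) lam lam)
    {𝕜 : Type*} [RCLike 𝕜] :
    (∀ F : X × Boundary r → 𝕜, Integrable F (lam.prod (boundaryMeasure r)) →
      (lam.prod (boundaryMeasure r))[F | groupInvariants (evenSubgroup r) (X × Boundary r)]
        =ᵐ[lam.prod (boundaryMeasure r)]
      (lam.prod (boundaryMeasure r))[F | relInvariants (horoRel (r := r) (X := X))]) ∧
    (∀ f : X × Boundary r → 𝕜, Integrable f (lam.prod (boundaryMeasure r)) →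
      (∀ φ : (X × Boundary r) ≃ᵐ (X × Boundary r), IsInner horoRel φ →
        f ∘ φ =ᵐ[lam.prod (boundaryMeasure r)] f) →
      f ∘ shiftMap 2 =ᵐ[lam.prod (boundaryMeasure r)] f) := by
  have := isProbabilityMeasure_boundaryMeasure hr
  refine ⟨fun F hF => ?_, fun f hf hinv => ?_⟩
  · exact condExp_ae_eq_of_le_of_forall_exists groupInvariants_le_relInvariants
      (relInvariants_le _) (fun s hs => exists_ae_eq_measurableSet_groupInvariants hr hlam hs) hF
  -- Invariance under all inner automorphisms is used only for those preserving some iterate of the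
  -- shift at each point. It passes to the real and imaginary parts, to which the real-valued result
  -- applies.
  · have hinner : ∀ φ : (X × Boundary r) ≃ᵐ (X × Boundary r),
        (∀ p, ∃ n, shift^[n] (φ p) = shift^[n] p) → IsInner horoRel φ := fun φ hφ p => by
      obtain ⟨n, hn⟩ := hφ p
      exact horoRel_of_iterate_shift_eq hn.symm
    have hre : IsTailInvariant (lam.prod (boundaryMeasure r)) fun p => RCLike.re (f p) :=
      fun φ hφ => (hinv φ (hinner φ hφ)).fun_comp RCLike.re
    have him : IsTailInvariant (lam.prod (boundaryMeasure r)) fun p => RCLike.im (f p) :=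
      fun φ hφ => (hinv φ (hinner φ hφ)).fun_comp RCLike.im
    rw [shiftMap_eq_iterate]
    filter_upwards [hre.comp_shift_shift hr hlam hf.re, him.comp_shift_shift hr hlam hf.im]
      with p h1 h2
    exact RCLike.ext h1 h2
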